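/- Start with $n$ cards numbered $1,\dots,n$ laid out in a row in increasing order. The card-cyclic to random insertion shuffle removes each of the cards $1,2,\dots,n$ once, in this order, and immediately reinserts it in a uniformly random one of the $n$ positions of the row, all choices being independent (so that the $n^n$ ways to perform the shuffle are equally likely). Let $P_n$ be the law of the resulting permutation $\sigma\in S_n$, where $\sigma_j$ is the number of the card in the $j$-th position from the left. Then the number $\sigma_1$ of the card in the first position behaves as follows. (i) If $b_n n\in\{1,\dots,n\}$ for all large $n$ and $\lim_{n\to\infty}b_n=b\in(0,1]$, then $$\lim_{n\to\infty} n\,P_n(\sigma_1=b_n n)=e^{b-1}.$$ Moreover, the laws $\nu_n(A)=P_n(\sigma_1\in nA)$, $A\subset[0,1]$, converge weakly on $[0,1]$ to the probability measure $e^{-1}\delta_0(dx)+e^{x-1}\,dx$. (ii) If $b_n n\in\{1,\dots,n\}$ for all large $n$, $\lim_{n\to\infty}b_n=0$ and $\liminf_{n\to\infty}\frac{\sqrt n}{\sqrt{\log n}}\,b_n>\sqrt2$, then $$\lim_{n\to\infty} n\,P_n(\sigma_1=b_n n)=e^{-1}.$$ (iii) If $d_n\sqrt n\in\{1,\dots,n\}$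 for all large $n$ and $\lim_{n\to\infty}d_n=d\in[0,\infty]$, then $$\lim_{n\to\infty} \sqrt n\,P_n(\sigma_1=d_n\sqrt n)=e^{-1}\int_d^\infty e^{-y^2/2}\,dy$$ (which is $0$ if $d=\infty$). Moreover, the measures $\mu_n(A)=P_n(\sigma_1\in \sqrt n A)$, $A\subset[0,\infty)$, converge to $$\mu(dx)=e^{-1}\Big(\int_x^\infty e^{-y^2/2}\,dy\Big)dx$$ in the sense that $\int f\,d\mu_n\to\int f\,d\mu$ for every continuous $f:[0,\infty)\to\mathbb R$ vanishing at infinity, and $\mu$ has total mass $e^{-1}$. -/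

import Mathlib

open MeasureTheory Filter Topology
open scoped NNReal ENNReal ZeroAtInfty

namespace CardCyclic

/-- A deck of `n` cards laid out in a row, as a permutation `σ`: `σ i` is the card in position `i`.
Positions and cards are labelled by `Fin n`, so the label `i` stands for the number `i + 1`. -/
abbrev Deck (n : ℕ) : Type := Equiv.Perm (Fin n)

instance instMeasurableSpaceDeck (n : ℕ) : MeasurableSpace (Deck n) := ⊤

/-- Remove the card `c` from the deck `σ` and reinsert it so that it ends up in position `k`;
the other cards keep their relative order. -/
def moveCard : {n : ℕ} → Deck n → Fin n → Fin n → Deck n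
  | 0, σ, _, _ => σ
  | _ + 1, σ, c, k => ((finSuccEquiv' k).trans (finSuccEquiv' (σ.symm c)).symm).trans σ

/-- The moved card is in position `k`. -/
theorem moveCard_self {m : ℕ} (σ : Deck (m + 1)) (c k : Fin (m + 1)) :
    moveCard σ c k k = c := by
  simp [moveCard]

/-- The `i`-th of the other cards, in left to right order, is the same before and after the move. -/
theorem moveCard_succAbove {m : ℕ} (σ : Deck (m + 1)) (c k : Fin (m + 1)) (i : Fin m) :
    moveCard σ c k (k.succAbove i) = σ ((σ.symm c).succAbove i) := by
  simp [moveCard]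

/-- The final deck when every card of `σ` is removed and reinserted exactly once, in the left to
right order of the original deck `σ`, the card originally in position `i` being reinserted in
position `k i`. -/
def shuffle {n : ℕ} (σ : Deck n) (k : Fin n → Fin n) : Deck n :=
  (List.finRange n).foldl (fun τ i => moveCard τ (σ i) (k i)) σ

instance instNonemptyPositions (n : ℕ) : Nonempty (Fin n → Fin n) := ⟨id⟩

/-- The law `p_n(σ, ·)` of the card-cyclic to random insertion shuffle started from `σ`: the
reinsertion positions are independent and uniform, that is, the `n ^ n` choices of all the
positions are equally likely. -/
noncomputable def shuffleLaw {n : ℕ} (σ : Deck n) : Measure (Deck n) :=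
  ((PMF.uniformOfFintype (Fin n → Fin n)).map (shuffle σ)).toMeasure

instance instIsProbabilityMeasureShuffleLaw {n : ℕ} (σ : Deck n) :
    IsProbabilityMeasure (shuffleLaw σ) := by
  unfold shuffleLaw; infer_instance

/-- The number `σ_1 ∈ {1, …, n}` of the card in the first position (`0` for the empty deck). -/
def firstCard : {n : ℕ} → Deck n → ℕ
  | 0, _ => 0
  | _ + 1, σ => (σ 0 : ℕ) + 1

theorem firstCard_le {n : ℕ} (σ : Deck n) : firstCard σ ≤ n := by
  cases n with
  | zero => exact le_rfl
  | succ m => exact (σ 0).isLt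

/-- The probability `p_n(id, {σ_1 = x})`. -/
noncomputable def probFirst (n : ℕ) (x : ℝ) : ℝ :=
  (shuffleLaw (1 : Deck n)).real {σ | (firstCard σ : ℝ) = x}

/-- `x` is the number of one of the `n` cards. -/
def IsCardNumber (n : ℕ) (x : ℝ) : Prop := ∃ j : ℕ, 1 ≤ j ∧ j ≤ n ∧ x = j

/-- `σ_1 / n` as a point of `[0, 1]`. -/
noncomputable def firstCardUnit {n : ℕ} (σ : Deck n) : unitInterval :=
  ⟨(firstCard σ : ℝ) / n, by positivity,
    div_le_one_of_le₀ (by exact_mod_cast firstCard_le σ) (by positivity)⟩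

/-- `σ_1 / √n` as a point of `[0, ∞)`. -/
noncomputable def firstCardSqrt {n : ℕ} (σ : Deck n) : ℝ≥0 :=
  (firstCard σ : ℝ≥0) / NNReal.sqrt n

/-- The law of `σ_1 / n` under `p_n(id, ·)`, a probability measure on `[0, 1]`. -/
noncomputable def nuF (n : ℕ) : ProbabilityMeasure unitInterval :=
  ⟨(shuffleLaw (1 : Deck n)).map firstCardUnit,
    Measure.isProbabilityMeasure_map (Measurable.of_discrete).aemeasurable⟩

/-- The measure `e⁻¹ δ_0 + e^{x - 1} dx` on `[0, 1]`. -/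
noncomputable def nuLimitMeasure : Measure unitInterval :=
  ENNReal.ofReal (Real.exp (-1)) • Measure.dirac 0 +
    (volume : Measure unitInterval).withDensity (fun x => ENNReal.ofReal (Real.exp ((x : ℝ) - 1)))

instance instIsProbabilityMeasureNuLimit : IsProbabilityMeasure nuLimitMeasure := by
  refine ⟨?_⟩
  have h1 : ∫⁻ x : unitInterval, ENNReal.ofReal (Real.exp ((x : ℝ) - 1)) =
      ENNReal.ofReal (1 - Real.exp (-1)) := by
    rw [unitInterval.measurePreserving_coe.lintegral_comp
        (f := fun x : ℝ => ENNReal.ofReal (Real.exp (x - 1))) (by fun_prop),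
      ← ofReal_integral_eq_lintegral_ofReal
        ((by fun_prop : Continuous fun x : ℝ => Real.exp (x - 1)).integrableOn_Icc)
        (ae_of_all _ fun x => (Real.exp_pos _).le),
      integral_Icc_eq_integral_Ioc, ← intervalIntegral.integral_of_le zero_le_one,
      intervalIntegral.integral_comp_sub_right (fun x => Real.exp x) 1, integral_exp]
    simp
  have h2 : Real.exp (-1) ≤ 1 := Real.exp_le_one_iff.2 (by norm_num)
  simp only [nuLimitMeasure, Measure.add_apply, Measure.smul_apply, smul_eq_mul, measure_univ,
    mul_one, withDensity_apply _ MeasurableSet.univ, Measure.restrict_univ, h1]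
  rw [← ENNReal.ofReal_add (Real.exp_pos _).le (by linarith)]
  simp

/-- `e⁻¹ δ_0 + e^{x - 1} dx` as a probability measure on `[0, 1]`. -/
noncomputable def nuLimit : ProbabilityMeasure unitInterval := ⟨nuLimitMeasure, inferInstance⟩

/-- The law of `σ_1 / √n` under `p_n(id, ·)`, a measure on `[0, ∞)`. -/
noncomputable def muF (n : ℕ) : Measure ℝ≥0 :=
  (shuffleLaw (1 : Deck n)).map firstCardSqrt

/-- The Gaussian tail integral `∫_d^∞ e^{-y²/2} dy`. -/
noncomputable def gaussTail (d : ℝ) : ℝ := ∫ y in Set.Ioi d, Real.exp (-(y ^ 2 / 2))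

/-- The measure `e⁻¹ (∫_x^∞ e^{-y²/2} dy) dx` on `[0, ∞)`. -/
noncomputable def muLimit : Measure ℝ≥0 :=
  ((volume : Measure ℝ).comap ((↑) : ℝ≥0 → ℝ)).withDensity
    (fun x => ENNReal.ofReal (Real.exp (-1) * gaussTail x))

end CardCyclic

/-! During the shuffle the deck starts with a run `r, r + 1, …` of cards not moved yet, followed by
a moved card. Only the length of the run and the card behind it matter (`runLength`, `runCard`).
Moving card `r` shortens a nonempty run by one; if the card lands inside or directly behind what is
left, it cuts the run there and becomes the card behind it. In the end the run is empty and the card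
behind it is in front (`firstCard_shuffle`).

Given the position `u` of card `j`, the event that `j` ends in front splits into one condition on
each other position (`firstCard_shuffle_eq_iff`). If `u` is the front, earlier cards are free and
later ones must avoid the front. Otherwise the numbers of forbidden positions are `1, …, t`, each
for one card, and `1` for the remaining cards, so the product depends on `u` and `j` only through
`t`, which is `u + j` for labels from `0`. Summing over `u`, with cards numbered from `1`, gives the
exact law `n P(σ_1 = j) = (1 - 1/n)^(n - j) + ∑_{t ≥ j} avoidProb n t` (`probFirst_natCast`).

The power lives on the scale `n` and tends to `e^(b - 1)`. Since `avoidProb n t ≈ e⁻¹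
exp(-t²/(2n))`, the sum lives on the scale `√n`, carries mass `e⁻¹` in the limit, and is negligible
once `j ≥ c √(n log n)` with `c > √2`. Sums are written as integrals of step functions
(`integral_comp_ceil_mul`), and dominated convergence gives the limits. -/

namespace CardCyclic

/-! ### Evolution of the leading run of unmoved cards -/

/-- The deck `τ` starts with the `L` cards `r, r + 1, …`, followed by the card `F < r`
(unless `r = 0` and the run is the whole deck). -/
def HasRun {m : ℕ} (τ : Deck (m + 1)) (r L F : ℕ) : Prop :=
  (∀ p : Fin (m + 1), (p : ℕ) < L → (τ p : ℕ) = r + p) ∧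
    (r = 0 ∧ L = m + 1 ∨ F < r ∧ ∃ p : Fin (m + 1), (p : ℕ) = L ∧ (τ p : ℕ) = F)

theorem moveCard_apply_of_lt {m : ℕ} (τ : Deck (m + 1)) (c k : Fin (m + 1)) (h0 : τ 0 = c)
    (p p' : Fin (m + 1)) (hp : (p : ℕ) < k) (hp' : (p' : ℕ) = p + 1) :
    moveCard τ c k p = τ p' := by
  have hpm : (p : ℕ) < m := by omega
  have e1 : k.succAbove ⟨p, hpm⟩ = p := by
    rw [Fin.succAbove_of_castSucc_lt k ⟨p, hpm⟩ (Fin.lt_def.2 hp)]; rfl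
  have h := moveCard_succAbove τ c k ⟨p, hpm⟩
  rw [e1] at h
  rw [h, ← h0, Equiv.symm_apply_apply, Fin.zero_succAbove]
  congr 1
  ext
  simp [hp']

theorem moveCard_apply_zero {m : ℕ} (τ : Deck (m + 1)) (c k : Fin (m + 1)) (h0 : τ 0 ≠ c)
    (hk : 0 < (k : ℕ)) : moveCard τ c k 0 = τ 0 := by
  have hm : 0 < m := by omega
  obtain ⟨m, rfl⟩ : ∃ m', m = m' + 1 := ⟨m - 1, by omega⟩
  have hq : τ.symm c ≠ 0 := fun h => h0 (by rw [← h, Equiv.apply_symm_apply])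
  have h := moveCard_succAbove τ c k 0
  rwa [Fin.succAbove_ne_zero_zero (by intro h; simp [h] at hk), Fin.succAbove_ne_zero_zero hq]
    at h

/-- A nonempty run has card `r` in front, and `L - 1` cards remain once it is lifted. Landing at `k
≤ L - 1` puts it behind the first `k` of them; landing further right leaves them followed by `F`. -/
theorem HasRun.moveCard {m : ℕ} {τ : Deck (m + 1)} {r L F : ℕ} (h : HasRun τ r L F)
    (c k : Fin (m + 1)) (hc : (c : ℕ) = r) :
    HasRun (moveCard τ c k) (r + 1) (min (k : ℕ) (L - 1))
      (if (k : ℕ) ≤ L - 1 then r else F) := by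
  obtain ⟨h1, h2⟩ := h
  rcases Nat.eq_zero_or_pos L with rfl | hL
  -- For an empty run `L - 1` is truncated to `0`: only an insertion in front replaces `F`.
  · have h2' : F < r ∧ ∃ p : Fin (m + 1), (p : ℕ) = 0 ∧ (τ p : ℕ) = F := by
      rcases h2 with h2 | h2
      · omega
      · exact h2
    obtain ⟨hF, p, hp, hpF⟩ := h2'
    obtain rfl : p = 0 := Fin.ext hp
    refine ⟨fun p hp => by simp at hp, Or.inr ?_⟩
    by_cases hk : (k : ℕ) = 0
    · obtain rfl : k = 0 := Fin.ext hk
      exact ⟨by simp, 0, by simp, by rw [moveCard_self]; simp [hc]⟩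
    · have hne : τ 0 ≠ c := by intro h; rw [← hpF, h] at hF; omega
      have := moveCard_apply_zero τ c k hne (by omega)
      refine ⟨by simp [hk]; omega, 0, by simp, by rw [this]; simp [hk, hpF]⟩
  · have h0 : τ 0 = c := Fin.ext (by rw [h1 0 (by simpa using hL), hc]; simp)
    have hLm : L ≤ m + 1 := by
      rcases h2 with h2 | ⟨-, p, hp, -⟩ <;> omega
    refine ⟨fun p hp => ?_, Or.inr ?_⟩
    · have hp1 : (p : ℕ) + 1 < m + 1 := by omega
      rw [moveCard_apply_of_lt τ c k h0 p ⟨p + 1, hp1⟩ (by omega) rfl, h1 _ (by simp; omega)]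
      simp; omega
    · by_cases hk : (k : ℕ) ≤ L - 1
      · refine ⟨by simp [hk], k, by omega, by rw [moveCard_self]; simp [hk, hc]⟩
      · rcases h2 with h2 | ⟨hF, p, hp, hpF⟩
        -- The run cannot be the whole deck, as then `k ≤ m = L - 1`.
        · omega
        · refine ⟨by simp [hk]; omega, ⟨L - 1, by omega⟩, by simp; omega, ?_⟩
          rw [moveCard_apply_of_lt τ c k h0 _ p (by simp; omega) (by simp; omega), hpF]
          simp [hk]

/-- The length of the leading run of cards not moved yet, after `r` moves. -/
def runLength (n : ℕ) (k : ℕ → ℕ) : ℕ → ℕ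
  | 0 => n
  | r + 1 => min (k r) (runLength n k r - 1)

/-- The card that follows the leading run of cards not moved yet, after `r` moves. -/
def runCard (n : ℕ) (k : ℕ → ℕ) : ℕ → ℕ
  | 0 => n
  | r + 1 => if k r ≤ runLength n k r - 1 then r else runCard n k r

/-- Apart from truncation, `runLength n k r + r` is the minimum of `n` and the `k i + i + 1` with `i
< r`. Phrased with `l <`, the claim is unaffected by truncation. -/
theorem lt_runLength_iff (n : ℕ) (k : ℕ → ℕ) (r l : ℕ) :
    l < runLength n k r ↔ l + r < n ∧ ∀ i < r, l + r ≤ k i + i := by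
  induction r generalizing l with
  | zero => simp [runLength]
  | succ r ih =>
    have : l < runLength n k (r + 1) ↔ l < k r ∧ l + 1 < runLength n k r := by
      simp only [runLength]; omega
    rw [this, ih]
    constructor
    · rintro ⟨h1, h2, h3⟩
      refine ⟨by omega, fun i hi => ?_⟩
      rcases Nat.lt_succ_iff_lt_or_eq.1 hi with hi | rfl
      · have := h3 i hi; omega
      · omega
    · rintro ⟨h1, h2⟩
      refine ⟨by have := h2 r (by omega); omega, by omega, fun i hi => ?_⟩
      have := h2 i (by omega); omega

/-- The initial value `n` is no card label, so card `j` cannot be recorded before it is moved. -/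
theorem runCard_lt_or_eq (n : ℕ) (k : ℕ → ℕ) (r : ℕ) : runCard n k r < r ∨ runCard n k r = n := by
  induction r with
  | zero => simp [runCard]
  | succ r ih => rw [runCard]; split_ifs <;> omega

/-- Induction on the number `e` of moves after that of card `j`. As long as `j` follows the run,
each move costs the run one card, so its length is `k j - e`; this is what decides whether the next
card displaces `j`. A displaced `j` never returns. -/
theorem runCard_eq_iff_aux (n : ℕ) (k : ℕ → ℕ) (j e : ℕ) (hj : j < n) :
    (runCard n k (j + 1 + e) = j ↔ k j ≤ runLength n k j - 1 ∧
      ∀ m < e, k j - (m + 1) < k (j + 1 + m)) ∧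
    (runCard n k (j + 1 + e) = j → runLength n k (j + 1 + e) = k j - e) := by
  induction e with
  | zero =>
    have hne : runCard n k j ≠ j := by
      rcases runCard_lt_or_eq n k j with h | h <;> omega
    simp only [runCard, runLength, not_lt_zero, false_implies, implies_true, and_true]
    split_ifs with h
    · simp [h]
    · simp [h, hne]
  | succ e ih =>
    obtain ⟨ih1, ih2⟩ := ih
    rw [← add_assoc, runCard, runLength]
    by_cases hF : runCard n k (j + 1 + e) = j
    · rw [ih2 hF, hF]
      have h3 := ih1.1 hF
      split_ifs with h
      · refine ⟨⟨fun h' => by omega, fun h' => ?_⟩, fun h' => by omega⟩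
        have := h'.2 e (by omega)
        omega
      · refine ⟨⟨fun _ => ⟨h3.1, fun m hm => ?_⟩, fun _ => rfl⟩, fun h' => by omega⟩
        rcases Nat.lt_succ_iff_lt_or_eq.1 hm with hm | rfl
        · exact h3.2 m hm
        · omega
    · have hne : ¬ (if k (j + 1 + e) ≤ runLength n k (j + 1 + e) - 1 then j + 1 + e
          else runCard n k (j + 1 + e)) = j := by
        split_ifs <;> omega
      refine ⟨⟨fun h => absurd h hne, fun h => absurd (ih1.2 ⟨h.1, fun m hm => ?_⟩) hF⟩,
        fun h => absurd h hne⟩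
      exact h.2 m (by omega)

theorem runCard_eq_iff (n : ℕ) (k : ℕ → ℕ) (j : ℕ) (hj : j < n) (hk : ∀ i < n, k i < n) :
    runCard n k n = j ↔ (k j = 0 ∨ ∀ i < j, k j + j ≤ k i + i) ∧
      ∀ i < n, j < i → k j - (i - j) < k i := by
  obtain ⟨e, rfl⟩ : ∃ e, n = j + 1 + e := ⟨n - (j + 1), by omega⟩
  rw [(runCard_eq_iff_aux _ k j e hj).1]
  -- `k j = 0` stands apart because it also works when the run is already exhausted.
  have h1 : k j ≤ runLength (j + 1 + e) k j - 1 ↔ k j = 0 ∨ k j < runLength (j + 1 + e) k j := by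
    omega
  rw [h1, lt_runLength_iff]
  refine and_congr (or_congr_right ⟨fun h => h.2, fun h => ⟨?_, h⟩⟩)
    ⟨fun h i hi hji => ?_, fun h m hm => ?_⟩
  -- The bound `k j + j < n` follows from the condition at `i = 0`, as `k 0 < n`.
  · rcases Nat.eq_zero_or_pos j with rfl | hj0
    · simpa using hk 0 hj
    · have := h 0 hj0
      have := hk 0 (by omega)
      omega
  · have := h (i - (j + 1)) (by omega)
    rwa [show j + 1 + (i - (j + 1)) = i by omega, show i - (j + 1) + 1 = i - j by omega] at this
  · have := h (j + 1 + m) (by omega) (by omega)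
    rwa [show j + 1 + m - j = m + 1 by omega] at this

/-- A family of positions as a sequence of natural numbers. -/
def positionSeq {n : ℕ} (k : Fin n → Fin n) (i : ℕ) : ℕ := if h : i < n then k ⟨i, h⟩ else 0

theorem hasRun_foldl {m : ℕ} (k : Fin (m + 1) → Fin (m + 1)) (r : ℕ) (hr : r ≤ m + 1) :
    HasRun (((List.finRange (m + 1)).take r).foldl
        (fun τ i => moveCard τ ((1 : Deck (m + 1)) i) (k i)) 1)
      r (runLength (m + 1) (positionSeq k) r) (runCard (m + 1) (positionSeq k) r) := by
  induction r with
  | zero => exact ⟨fun p _ => by simp, Or.inl ⟨rfl, rfl⟩⟩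
  | succ r ih =>
    have hlen : r < (List.finRange (m + 1)).length := by simp; omega
    rw [← List.take_concat_get' _ _ hlen, List.foldl_append, List.foldl_cons, List.foldl_nil]
    have h := (ih (by omega)).moveCard ⟨r, hr⟩ (k ⟨r, hr⟩) rfl
    have hp : positionSeq k r = k ⟨r, hr⟩ := dif_pos hr
    rw [runLength, runCard, hp]
    simpa using h

theorem firstCard_shuffle {m : ℕ} (k : Fin (m + 1) → Fin (m + 1)) :
    firstCard (shuffle 1 k) = runCard (m + 1) (positionSeq k) (m + 1) + 1 := by
  have h := hasRun_foldl k (m + 1) le_rfl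
  rw [List.take_of_length_le (by simp)] at h
  obtain ⟨h1, h2⟩ := h
  -- A nonempty run would start with the card labelled `m + 1`, which does not exist.
  have hL : runLength (m + 1) (positionSeq k) (m + 1) = 0 := by
    by_contra hL
    have := h1 0 (by simp; omega)
    omega
  rcases h2 with h2 | ⟨-, p, hp, hpF⟩
  · omega
  · obtain rfl : p = 0 := Fin.ext (hp.trans hL)
    simp only [firstCard, shuffle, Nat.add_right_cancel_iff]
    exact hpF

theorem firstCard_shuffle_eq_iff {n : ℕ} (k : Fin n → Fin n) (j : Fin n) :
    firstCard (shuffle 1 k) = j + 1 ↔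
      (((k j : ℕ) = 0 ∨ ∀ i : Fin n, i < j → (k j : ℕ) + j ≤ k i + i) ∧
        ∀ i : Fin n, j < i → (k j : ℕ) - (i - j) < k i) := by
  obtain ⟨m, rfl⟩ : ∃ m, n = m + 1 := ⟨n - 1, by have := j.2; omega⟩
  have hp : ∀ (i : ℕ) (h : i < m + 1), positionSeq k i = k ⟨i, h⟩ := fun i h => dif_pos h
  rw [firstCard_shuffle, Nat.add_right_cancel_iff, runCard_eq_iff _ _ _ j.2
    (fun i hi => by rw [hp i hi]; exact (k _).2), hp j j.2]
  refine and_congr (or_congr_right ⟨fun h i hi => ?_, fun h i hi => ?_⟩)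
    ⟨fun h i hi => ?_, fun h i hi hji => ?_⟩
  · simpa [hp i i.2] using h i hi
  · rw [hp i (by omega)]; exact h ⟨i, by omega⟩ hi
  · simpa [hp i i.2] using h i i.2 hi
  · rw [hp i hi]; exact h ⟨i, hi⟩ hji

/-! ### The exact law of the first card -/

theorem card_filter_le_val (n c : ℕ) :
    (Finset.univ.filter fun x : Fin n => c ≤ (x : ℕ)).card = n - c := by
  have : (Finset.univ.filter fun x : Fin n => c ≤ (x : ℕ)).map Fin.valEmbedding
      = Finset.Ico c n := by
    ext x
    simp only [Finset.mem_map, Finset.mem_filter, Finset.mem_univ, true_and,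
      Fin.valEmbedding_apply, Finset.mem_Ico]
    exact ⟨by rintro ⟨y, hy, rfl⟩; exact ⟨hy, y.2⟩, fun h => ⟨⟨x, h.2⟩, h.1, rfl⟩⟩
  rw [← Finset.card_map Fin.valEmbedding, this, Nat.card_Ico]

/-- The number of admissible positions of card `i` in the shuffles that put card `j` in front after
inserting it in position `u`. -/
def positionCount (n j u i : ℕ) : ℕ :=
  if i < j then (if u = 0 then n else n - (u + j - i)) else if i = j then 1
    else n - (u - (i - j) + 1)

/-- Once `k j = u` is fixed, the conditions on the other positions decouple and the favourable
choices form a product set. -/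
theorem card_firstCard_shuffle (n : ℕ) (j : Fin n) :
    (Finset.univ.filter fun k : Fin n → Fin n => firstCard (shuffle 1 k) = j + 1).card =
      ∑ u ∈ Finset.range n, ∏ i ∈ Finset.range n, positionCount n j u i := by
  rw [Finset.card_eq_sum_card_fiberwise (f := fun k : Fin n → Fin n => k j) (t := Finset.univ)
    (by simp [Set.MapsTo]),
    ← Fin.sum_univ_eq_sum_range (fun u => ∏ i ∈ Finset.range n, positionCount n j u i)]
  refine Finset.sum_congr rfl fun u _ => ?_
  rw [← Fin.prod_univ_eq_prod_range (fun i => positionCount n j u i)]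
  have : (Finset.univ.filter fun k : Fin n → Fin n => firstCard (shuffle 1 k) = j + 1).filter
      (fun k => k j = u) = Fintype.piFinset fun i : Fin n =>
        if i < j then (Finset.univ.filter fun x : Fin n =>
            (if (u : ℕ) = 0 then 0 else (u : ℕ) + j - i) ≤ x)
        else if i = j then {u}
        else Finset.univ.filter fun x : Fin n => (u : ℕ) - (i - j) + 1 ≤ x := by
    ext k
    simp only [Finset.mem_filter, Finset.mem_univ, true_and, Fintype.mem_piFinset,
      firstCard_shuffle_eq_iff]
    constructor
    · rintro ⟨⟨h1, h2⟩, rfl⟩ i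
      split_ifs with h3 h4 h4
      · simp
      · simp only [Finset.mem_filter, Finset.mem_univ, true_and]
        have := (h1.resolve_left h4) i h3
        omega
      · simp [h4]
      · simp only [Finset.mem_filter, Finset.mem_univ, true_and]
        exact h2 i (by omega)
    · intro h
      have hu : k j = u := by simpa using h j
      refine ⟨⟨?_, fun i hi => ?_⟩, hu⟩
      · by_cases h0 : (k j : ℕ) = 0
        · exact Or.inl h0
        · refine Or.inr fun i hi => ?_
          have := h i
          rw [if_pos hi, ← hu, if_neg h0] at this
          simp only [Finset.mem_filter, Finset.mem_univ, true_and] at this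
          omega
      · have := h i
        rw [if_neg (by omega), if_neg (by omega)] at this
        simp only [Finset.mem_filter, Finset.mem_univ, true_and] at this
        rw [hu]
        exact this
  rw [this, Fintype.card_piFinset]
  refine Finset.prod_congr rfl fun i _ => ?_
  simp only [positionCount, Fin.val_fin_lt]
  by_cases h : i < j
  · rw [if_pos h, if_pos h, card_filter_le_val]
    split_ifs <;> simp
  · by_cases h' : i = j
    · simp [h']
    · have h'' : (i : ℕ) ≠ j := fun e => h' (Fin.ext e)
      rw [if_neg h, if_neg h', if_neg h, if_neg h'', card_filter_le_val]

/-- The probability that `t` uniform positions avoid `1, …, t` respectively and that the remaining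
`n - 1 - t` avoid the first one. -/
noncomputable def avoidProb (n t : ℕ) : ℝ :=
  (1 - 1 / (n : ℝ)) ^ (n - 1 - t) * ∏ s ∈ Finset.range t, (1 - ((s : ℝ) + 1) / n)

/-- The factor `s = n - 1` vanishes. This makes the truncated exponent `n - 1 - t` harmless and lets
ranges of `t` extend past `n`. -/
theorem avoidProb_eq_zero {n t : ℕ} (hn : 0 < n) (ht : n ≤ t) : avoidProb n t = 0 := by
  have : ∏ s ∈ Finset.range t, (1 - ((s : ℝ) + 1) / n) = 0 := by
    refine Finset.prod_eq_zero (i := n - 1) (by simp; omega) ?_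
    rw [Nat.cast_sub hn]
    have : (n : ℝ) ≠ 0 := by positivity
    simp; field_simp; simp
  rw [avoidProb, this, mul_zero]

theorem prod_positionCount_zero (n j : ℕ) (hj : j < n) :
    (∏ i ∈ Finset.range n, (positionCount n j 0 i : ℝ) / n) =
      (1 / n) * (1 - 1 / (n : ℝ)) ^ (n - (j + 1)) := by
  obtain ⟨e, rfl⟩ : ∃ e, n = j + 1 + e := ⟨n - (j + 1), by omega⟩
  have hn : ((j + 1 + e : ℕ) : ℝ) ≠ 0 := by positivity
  rw [Finset.prod_range_add, Finset.prod_range_succ, Finset.prod_eq_one]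
  · simp only [positionCount, lt_irrefl, if_false, if_true]
    rw [one_mul, Nat.add_sub_cancel_left]
    simp only [Nat.cast_one]
    congr 1
    rw [Finset.prod_eq_pow_card (b := 1 - 1 / ((j + 1 + e : ℕ) : ℝ)) , Finset.card_range]
    intro m _
    rw [if_neg (by omega), if_neg (by omega), zero_tsub, Nat.cast_sub (by omega)]
    field_simp
    simp
  · intro i hi
    simp only [Finset.mem_range] at hi
    rw [positionCount, if_pos hi, if_pos rfl, div_self hn]

/-- Going back from card `j - 1` to card `0`, the numbers of forbidden positions are `u + 2, …, u +
1 + j`; going on from card `j + 1` they are `u + 1, …, 1` and then always `1`. Together they exhaust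
`1, …, u + (j + 1)`. -/
theorem prod_positionCount_succ (n j u : ℕ) (hj : j < n) (hu : u + 1 < n) :
    (∏ i ∈ Finset.range n, (positionCount n j (u + 1) i : ℝ) / n) =
      (1 / n) * avoidProb n (u + (j + 1)) := by
  rcases Nat.lt_or_ge (u + (j + 1)) n with h | h
  · obtain ⟨e, rfl⟩ : ∃ e, n = j + 1 + ((u + 1) + e) := ⟨n - (u + (j + 1) + 1), by omega⟩
    have hn : ((j + 1 + ((u + 1) + e) : ℕ) : ℝ) ≠ 0 := by positivity
    set n := j + 1 + ((u + 1) + e) with hndef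
    have key : ∀ c ≤ n, ((n - c : ℕ) : ℝ) / n = 1 - (c : ℝ) / n := by
      intro c hc
      rw [Nat.cast_sub hc]; field_simp
    conv_lhs => rw [hndef, Finset.prod_range_add, Finset.prod_range_succ, Finset.prod_range_add]
    have h1 : ∏ i ∈ Finset.range j, (positionCount n j (u + 1) i : ℝ) / n =
        ∏ i ∈ Finset.range j, (1 - (((u + 1 + i : ℕ) : ℝ) + 1) / n) := by
      rw [← Finset.prod_range_reflect]
      refine Finset.prod_congr rfl fun i hi => ?_
      simp only [Finset.mem_range] at hi
      rw [positionCount, if_pos (by omega), if_neg (by omega), key _ (by omega)]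
      congr 2
      rw [show u + 1 + j - (j - 1 - i) = u + 1 + i + 1 by omega]
      push_cast; ring
    have h2 : ∏ i ∈ Finset.range (u + 1), (positionCount n j (u + 1) (j + 1 + i) : ℝ) / n =
        ∏ i ∈ Finset.range (u + 1), (1 - ((i : ℝ) + 1) / n) := by
      rw [← Finset.prod_range_reflect]
      refine Finset.prod_congr rfl fun i hi => ?_
      simp only [Finset.mem_range] at hi
      rw [positionCount, if_neg (by omega), if_neg (by omega), key _ (by omega)]
      congr 2
      rw [show u + 1 - (j + 1 + (u + 1 - 1 - i) - j) + 1 = i + 1 by omega]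
      push_cast; ring
    have h3 : ∏ i ∈ Finset.range e,
        (positionCount n j (u + 1) (j + 1 + (u + 1 + i)) : ℝ) / n = (1 - 1 / (n : ℝ)) ^ e := by
      rw [Finset.prod_eq_pow_card (b := 1 - 1 / (n : ℝ)), Finset.card_range]
      intro i _
      rw [positionCount, if_neg (by omega), if_neg (by omega), key _ (by omega)]
      congr 2
      rw [show u + 1 - (j + 1 + (u + 1 + i) - j) + 1 = 1 by omega]
      simp
    have h4 : (positionCount n j (u + 1) j : ℝ) / n = 1 / n := by simp [positionCount]
    rw [h1, h2, h3, h4, avoidProb, show n - 1 - (u + (j + 1)) = e by omega,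
      show u + (j + 1) = (u + 1) + j by ring,
      Finset.prod_range_add (fun s : ℕ => 1 - ((s : ℝ) + 1) / n) (u + 1) j]
    ac_rfl
  -- Here card `0` has no admissible position; `j = 0` is excluded by `u + 1 < n`.
  · rw [avoidProb_eq_zero (by omega) h, mul_zero]
    refine Finset.prod_eq_zero (i := 0) (by simp; omega) ?_
    rw [positionCount]
    rcases Nat.eq_zero_or_pos j with rfl | hj0
    · omega
    · rw [if_pos hj0, if_neg (by omega), show n - (u + 1 + j - 0) = 0 by omega]
      simp

/-- The probability that no card is inserted in the first position and that the card `j` ends up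
there is `avoidSum n j / n`. -/
noncomputable def avoidSum (n j : ℕ) : ℝ := ∑ t ∈ Finset.Icc j n, avoidProb n t

theorem shuffleLaw_real_apply {n : ℕ} (σ : Deck n) (s : Set (Deck n)) [DecidablePred (· ∈ s)] :
    (shuffleLaw σ).real s =
      ((Finset.univ.filter fun k : Fin n → Fin n => shuffle σ k ∈ s).card : ℝ) / (n : ℝ) ^ n := by
  classical
  let _ : MeasurableSpace (Fin n → Fin n) := ⊤
  have hs : MeasurableSet s := MeasurableSpace.measurableSet_top
  rw [Measure.real, shuffleLaw, PMF.toMeasure_map_apply _ _ _ (Measurable.of_discrete) hs,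
    PMF.toMeasure_uniformOfFintype_apply _ MeasurableSpace.measurableSet_top]
  simp [ENNReal.toReal_div]

theorem probFirst_natCast {n j : ℕ} (h1 : 1 ≤ j) (hj : j ≤ n) :
    probFirst n j = (1 / n) * ((1 - 1 / (n : ℝ)) ^ (n - j) + avoidSum n j) := by
  classical
  obtain ⟨i, rfl⟩ : ∃ i, j = i + 1 := ⟨j - 1, by omega⟩
  obtain ⟨m, rfl⟩ : ∃ m, n = m + 1 := ⟨n - 1, by omega⟩
  have hcard := card_firstCard_shuffle (m + 1) ⟨i, hj⟩
  have hset : {σ : Deck (m + 1) | (firstCard σ : ℝ) = ((i + 1 : ℕ) : ℝ)} =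
      {σ | firstCard σ = i + 1} := by
    ext σ; simp only [Set.mem_ofPred_eq, Nat.cast_inj]
  rw [probFirst, hset, shuffleLaw_real_apply]
  simp only [Set.mem_ofPred_eq] at hcard ⊢
  rw [hcard, Nat.cast_sum, Finset.sum_div]
  have hprod : ∀ u, ((∏ i' ∈ Finset.range (m + 1), positionCount (m + 1) i u i' : ℕ) : ℝ) /
      ((m + 1 : ℕ) : ℝ) ^ (m + 1) =
      ∏ i' ∈ Finset.range (m + 1), (positionCount (m + 1) i u i' : ℝ) / ((m + 1 : ℕ) : ℝ) := by
    intro u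
    rw [Finset.prod_div_distrib, Finset.prod_const, Finset.card_range, Nat.cast_prod]
  simp only [hprod]
  rw [Finset.sum_range_succ', prod_positionCount_zero _ _ hj, mul_add, add_comm]
  congr 1
  rw [Finset.sum_congr rfl fun u hu => prod_positionCount_succ (m + 1) i u hj
    (by simp only [Finset.mem_range] at hu; omega), ← Finset.mul_sum]
  congr 1
  have e : ∑ u ∈ Finset.range m, avoidProb (m + 1) (u + (i + 1)) =
      ∑ t ∈ Finset.Ico (i + 1) (m + (i + 1)), avoidProb (m + 1) t := by
    rw [Finset.sum_Ico_eq_sum_range, Nat.add_sub_cancel]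
    exact Finset.sum_congr rfl fun u _ => by rw [add_comm u]
  rw [e, avoidSum]
  -- The ranges of `t` differ only where `t ≥ n`, and there the terms vanish.
  have hsub : ∀ s : Finset ℕ, Finset.Ico (i + 1) (m + 1) ⊆ s → (∀ t ∈ s, i + 1 ≤ t) →
      ∑ t ∈ Finset.Ico (i + 1) (m + 1), avoidProb (m + 1) t = ∑ t ∈ s, avoidProb (m + 1) t := by
    refine fun s hs h => Finset.sum_subset hs fun t ht ht' => avoidProb_eq_zero (by omega) ?_
    have := h t ht
    simp only [Finset.mem_Ico] at ht'
    omega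
  rw [← hsub (Finset.Ico _ _), ← hsub (Finset.Icc _ _)]
  all_goals
    intro t ht
    simp only [Finset.mem_Ico, Finset.mem_Icc] at ht ⊢
    omega

theorem integral_firstCard {n : ℕ} (hn : 0 < n) (g : ℕ → ℝ) :
    ∫ σ, g (firstCard σ) ∂(shuffleLaw (1 : Deck n)) =
      ∑ j ∈ Finset.Icc 1 n, g j * probFirst n j := by
  obtain ⟨m, rfl⟩ : ∃ m, n = m + 1 := ⟨n - 1, by omega⟩
  have h : ∀ σ : Deck (m + 1), g (firstCard σ) = ∑ j ∈ Finset.Icc 1 (m + 1),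
      {σ : Deck (m + 1) | (firstCard σ : ℝ) = j}.indicator (fun _ => g j) σ := by
    intro σ
    rw [Finset.sum_eq_single (firstCard σ)]
    · simp
    · intro j _ hj
      rw [Set.indicator_of_notMem]
      simpa using hj.symm
    · intro h
      exact absurd (Finset.mem_Icc.2 ⟨by simp [firstCard], firstCard_le σ⟩) h
  simp only [h]
  rw [integral_finsetSum]
  · refine Finset.sum_congr rfl fun j _ => ?_
    rw [integral_indicator_const _ MeasurableSpace.measurableSet_top, probFirst, smul_eq_mul, mul_comm]
  · intro j _
    exact (integrable_const _).indicator MeasurableSpace.measurableSet_top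

/-! ### Bounds and limits for `avoidProb` -/

theorem sum_range_succ_cast (t : ℕ) :
    ∑ s ∈ Finset.range t, ((s : ℝ) + 1) = (t : ℝ) * (t + 1) / 2 := by
  induction t with
  | zero => simp
  | succ t ih => rw [Finset.sum_range_succ, ih]; push_cast; ring

theorem one_sub_inv_natCast_nonneg {n : ℕ} (hn : 0 < n) : 0 ≤ 1 - 1 / (n : ℝ) := by
  have : (1 : ℝ) ≤ n := by exact_mod_cast hn
  rw [sub_nonneg, div_le_one (by linarith)]
  exact this

theorem one_sub_inv_natCast_le_one (n : ℕ) : 1 - 1 / (n : ℝ) ≤ 1 := by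
  have : 0 ≤ 1 / (n : ℝ) := by positivity
  linarith

theorem one_sub_succ_div_nonneg {n t s : ℕ} (ht : t < n) (hs : s ∈ Finset.range t) :
    0 ≤ 1 - ((s : ℝ) + 1) / n := by
  have h1 : s + 1 ≤ n := by simp only [Finset.mem_range] at hs; omega
  have h2 : (s : ℝ) + 1 ≤ n := by exact_mod_cast h1
  have h3 : (0 : ℝ) < n := by exact_mod_cast (show 0 < n by omega)
  rw [sub_nonneg, div_le_one h3]
  exact h2

theorem avoidProb_nonneg {n : ℕ} (hn : 0 < n) (t : ℕ) : 0 ≤ avoidProb n t := by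
  rcases Nat.lt_or_ge t n with h | h
  · exact mul_nonneg (pow_nonneg (one_sub_inv_natCast_nonneg hn) _)
      (Finset.prod_nonneg fun s hs => one_sub_succ_div_nonneg h hs)
  · rw [avoidProb_eq_zero hn h]

theorem prod_one_sub_le_exp {n t : ℕ} (ht : t < n) :
    ∏ s ∈ Finset.range t, (1 - ((s : ℝ) + 1) / n) ≤ Real.exp (-((t : ℝ) ^ 2 / (2 * n))) := by
  have hn : (0 : ℝ) < n := by exact_mod_cast (show 0 < n by omega)
  calc ∏ s ∈ Finset.range t, (1 - ((s : ℝ) + 1) / n)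
      ≤ ∏ s ∈ Finset.range t, Real.exp (-(((s : ℝ) + 1) / n)) :=
        Finset.prod_le_prod (fun s hs => one_sub_succ_div_nonneg ht hs)
          fun s _ => Real.one_sub_le_exp_neg _
    _ = Real.exp (-((t : ℝ) * (t + 1) / 2 / n)) := by
        rw [← Real.exp_sum, Finset.sum_neg_distrib, ← Finset.sum_div, sum_range_succ_cast]
    _ ≤ _ := by
        rw [Real.exp_le_exp, neg_le_neg_iff, div_div]
        gcongr
        nlinarith [(Nat.cast_nonneg t : (0 : ℝ) ≤ t)]

theorem avoidProb_le {n : ℕ} (hn : 0 < n) (t : ℕ) :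
    avoidProb n t ≤ Real.exp (-((t : ℝ) ^ 2 / (2 * n))) := by
  rcases Nat.lt_or_ge t n with h | h
  · rw [avoidProb, ← one_mul (Real.exp _)]
    exact mul_le_mul
      (pow_le_one₀ (one_sub_inv_natCast_nonneg hn) (one_sub_inv_natCast_le_one n))
      (prod_one_sub_le_exp h)
      (Finset.prod_nonneg fun s hs => one_sub_succ_div_nonneg h hs) zero_le_one
  · rw [avoidProb_eq_zero hn h]; positivity

/-- From `log z ≥ 1 - 1/z` comes `1 - x ≥ exp(-x/(1 - x))`, and `x ≤ t/n` in the denominator. For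
`t` of order `√n` this matches the upper bound from `1 - x ≤ exp(-x)`. -/
theorem exp_le_prod_one_sub {n t : ℕ} (ht : t < n) :
    Real.exp (-((t : ℝ) * (t + 1) / (2 * n) / (1 - t / n))) ≤
      ∏ s ∈ Finset.range t, (1 - ((s : ℝ) + 1) / n) := by
  have hn : (0 : ℝ) < n := by exact_mod_cast (show 0 < n by omega)
  have htn : (t : ℝ) < n := by exact_mod_cast ht
  have hd : 0 < 1 - (t : ℝ) / n := by rw [sub_pos, div_lt_one hn]; exact htn
  calc Real.exp (-((t : ℝ) * (t + 1) / (2 * n) / (1 - t / n)))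
      = ∏ s ∈ Finset.range t, Real.exp (-(((s : ℝ) + 1) / n / (1 - t / n))) := by
        rw [← Real.exp_sum, Finset.sum_neg_distrib, ← Finset.sum_div, ← Finset.sum_div,
          sum_range_succ_cast, div_div _ (2 : ℝ)]
    _ ≤ _ := by
        refine Finset.prod_le_prod (fun s _ => (Real.exp_pos _).le) fun s hs => ?_
        have hst : (s : ℝ) + 1 ≤ t := by
          simp only [Finset.mem_range] at hs; exact_mod_cast hs
        have hle : 1 - (t : ℝ) / n ≤ 1 - ((s : ℝ) + 1) / n := by gcongr
        have hpos : 0 < 1 - ((s : ℝ) + 1) / n := hd.trans_le hle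
        rw [← Real.le_log_iff_exp_le hpos]
        refine le_trans ?_ (Real.one_sub_inv_le_log_of_pos hpos)
        have e : 1 - (1 - ((s : ℝ) + 1) / n)⁻¹ = -(((s : ℝ) + 1) / n / (1 - ((s : ℝ) + 1) / n)) := by
          have := hpos.ne'
          set x := ((s : ℝ) + 1) / n
          field_simp; ring
        rw [e, neg_le_neg_iff]
        gcongr

theorem tendsto_one_sub_inv_pow {m : ℕ → ℕ} {b : ℝ}
    (h : Tendsto (fun n => (m n : ℝ) / n) atTop (𝓝 b)) :
    Tendsto (fun n : ℕ => (1 - 1 / (n : ℝ)) ^ m n) atTop (𝓝 (Real.exp (-b))) := by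
  have h1 := (Real.tendsto_mul_log_one_add_div_atTop (-1)).comp tendsto_natCast_atTop_atTop
  have h2 : Tendsto (fun n : ℕ => Real.exp (((m n : ℝ) / n) * (n * Real.log (1 + -1 / (n : ℝ)))))
      atTop (𝓝 (Real.exp (b * -1))) := (Real.continuous_exp.tendsto _).comp (h.mul h1)
  rw [mul_neg_one] at h2
  refine h2.congr' ?_
  filter_upwards [eventually_ge_atTop 2] with n hn
  have hn' : (2 : ℝ) ≤ n := by exact_mod_cast hn
  have hpos : 0 < 1 - 1 / (n : ℝ) := by
    rw [sub_pos, div_lt_one (by linarith)]; linarith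
  rw [← mul_assoc, div_mul_cancel₀ _ (by linarith), neg_div, ← sub_eq_add_neg, ← Real.log_pow,
    Real.exp_log (pow_pos hpos _)]

theorem tendsto_sqrt_natCast : Tendsto (fun n : ℕ => √(n : ℝ)) atTop atTop :=
  Real.tendsto_sqrt_atTop.comp tendsto_natCast_atTop_atTop

theorem tendsto_div_natCast_of_div_sqrt {t : ℕ → ℕ} {y : ℝ}
    (h : Tendsto (fun n => (t n : ℝ) / √n) atTop (𝓝 y)) :
    Tendsto (fun n => (t n : ℝ) / n) atTop (𝓝 0) := by
  have h1 := h.mul (tendsto_inv_atTop_zero.comp tendsto_sqrt_natCast)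
  rw [mul_zero] at h1
  refine h1.congr fun n => ?_
  simp only [Function.comp]
  rw [← div_eq_mul_inv, div_div, Real.mul_self_sqrt (Nat.cast_nonneg n)]

theorem eventually_lt_of_tendsto_div {t : ℕ → ℕ}
    (h : Tendsto (fun n => (t n : ℝ) / n) atTop (𝓝 0)) : ∀ᶠ n in atTop, t n < n := by
  filter_upwards [h.eventually (gt_mem_nhds one_pos), eventually_gt_atTop 0] with n hn hn0
  have h0 : (0 : ℝ) < n := by exact_mod_cast hn0
  rw [div_lt_one h0] at hn
  exact_mod_cast hn

theorem tendsto_prod_one_sub {t : ℕ → ℕ} {y : ℝ}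
    (h : Tendsto (fun n => (t n : ℝ) / √n) atTop (𝓝 y)) :
    Tendsto (fun n : ℕ => ∏ s ∈ Finset.range (t n), (1 - ((s : ℝ) + 1) / n)) atTop
      (𝓝 (Real.exp (-(y ^ 2 / 2)))) := by
  have h0 := tendsto_div_natCast_of_div_sqrt h
  have hsq : Tendsto (fun n => (t n : ℝ) ^ 2 / (2 * n)) atTop (𝓝 (y ^ 2 / 2)) := by
    refine ((h.pow 2).div_const 2).congr fun n => ?_
    rw [div_pow, Real.sq_sqrt (Nat.cast_nonneg n), div_div, mul_comm (n : ℝ)]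
  have hlow : Tendsto (fun n => (t n : ℝ) * (t n + 1) / (2 * n) / (1 - t n / n)) atTop
      (𝓝 (y ^ 2 / 2)) := by
    have h1 := (hsq.add (h0.div_const 2)).div (tendsto_const_nhds (x := (1 : ℝ)) |>.sub h0)
      (by norm_num)
    simp only [zero_div, add_zero, sub_zero, div_one] at h1
    refine h1.congr fun n => ?_
    simp only [Pi.div_apply]
    congr 1
    rw [div_div, mul_comm (n : ℝ), ← add_div]
    ring
  have ht := eventually_lt_of_tendsto_div h0
  refine tendsto_of_tendsto_of_tendsto_of_le_of_le'
    ((Real.continuous_exp.tendsto _).comp hlow.neg) ((Real.continuous_exp.tendsto _).comp hsq.neg)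
    ?_ ?_
  · filter_upwards [ht] with n hn using exp_le_prod_one_sub hn
  · filter_upwards [ht] with n hn using prod_one_sub_le_exp hn

theorem tendsto_avoidProb {t : ℕ → ℕ} {y : ℝ}
    (h : Tendsto (fun n => (t n : ℝ) / √n) atTop (𝓝 y)) :
    Tendsto (fun n : ℕ => avoidProb n (t n)) atTop
      (𝓝 (Real.exp (-1) * Real.exp (-(y ^ 2 / 2)))) := by
  have h0 := tendsto_div_natCast_of_div_sqrt h
  refine Tendsto.mul (tendsto_one_sub_inv_pow ?_) (tendsto_prod_one_sub h)
  have h1 : Tendsto (fun n : ℕ => 1 - 1 / (n : ℝ) - t n / n) atTop (𝓝 1) := by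
    simpa using ((tendsto_const_nhds (x := (1 : ℝ))).sub
      (tendsto_one_div_atTop_nhds_zero_nat (𝕜 := ℝ))).sub h0
  refine h1.congr' ?_
  filter_upwards [eventually_lt_of_tendsto_div h0] with n hn
  have : (n : ℝ) ≠ 0 := by exact_mod_cast (show n ≠ 0 by omega)
  rw [Nat.cast_sub (by omega), Nat.cast_sub (by omega)]
  field_simp
  simp

/-! ### The tail sums on the scale `√n` -/

theorem tendsto_ceil_mul_sqrt_div {y : ℝ} (hy : 0 ≤ y) :
    Tendsto (fun n : ℕ => (⌈y * √n⌉₊ : ℝ) / √n) atTop (𝓝 y) :=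
  (tendsto_nat_ceil_mul_div_atTop hy).comp tendsto_sqrt_natCast

theorem measurable_comp_ceil_mul (c : ℝ) (φ : ℕ → ℝ) :
    Measurable fun y : ℝ => φ ⌈y * c⌉₊ :=
  (measurable_from_top (f := φ)).comp (Nat.measurable_ceil.comp (measurable_id.mul_const c))

/-- The integrand is constant on each cell `(N/c, (N + 1)/c]`. Turning sums into integrals over a
fixed domain makes dominated convergence available. -/
theorem integral_comp_ceil_mul_aux {c : ℝ} (hc : 0 < c) (φ : ℕ → ℝ) (N : ℕ) :
    IntervalIntegrable (fun y : ℝ => φ ⌈y * c⌉₊) volume 0 (N / c) ∧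
      ∫ y in (0 : ℝ)..(N / c), φ ⌈y * c⌉₊ = (∑ t ∈ Finset.Icc 1 N, φ t) / c := by
  induction N with
  | zero => simp
  | succ N ih =>
    have hle : (N : ℝ) / c ≤ (N + 1 : ℕ) / c := by gcongr; omega
    have hconst : ∀ y ∈ Set.Ioc ((N : ℝ) / c) ((N + 1 : ℕ) / c), φ ⌈y * c⌉₊ = φ (N + 1) := by
      rintro y ⟨h1, h2⟩
      rw [div_lt_iff₀ hc] at h1
      rw [le_div_iff₀ hc] at h2
      rw [(Nat.ceil_eq_iff (by omega)).2 ⟨by simpa using h1, h2⟩]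
    have hint : IntervalIntegrable (fun y : ℝ => φ ⌈y * c⌉₊) volume (N / c) ((N + 1 : ℕ) / c) := by
      refine (intervalIntegrable_const (c := φ (N + 1))).congr fun y hy => ?_
      rw [Set.uIoc_of_le hle] at hy
      exact (hconst y hy).symm
    refine ⟨ih.1.trans hint, ?_⟩
    rw [← intervalIntegral.integral_add_adjacent_intervals ih.1 hint, ih.2,
      Finset.sum_Icc_succ_top (by omega), intervalIntegral.integral_of_le hle,
      setIntegral_congr_fun measurableSet_Ioc hconst, ← intervalIntegral.integral_of_le hle,
      intervalIntegral.integral_const, smul_eq_mul]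
    push_cast
    field_simp
    ring

theorem integral_comp_ceil_mul {c : ℝ} (hc : 0 < c) (φ : ℕ → ℝ) (N : ℕ)
    (hφ : ∀ t, N < t → φ t = 0) :
    ∫ y in Set.Ioi (0 : ℝ), φ ⌈y * c⌉₊ = (∑ t ∈ Finset.Icc 1 N, φ t) / c := by
  rw [← (integral_comp_ceil_mul_aux hc φ N).2, intervalIntegral.integral_of_le (by positivity)]
  refine setIntegral_eq_of_subset_of_forall_sdiff_eq_zero measurableSet_Ioi
    (fun y hy => hy.1) fun y hy => hφ _ ?_
  have h1 : (0 : ℝ) < y := hy.1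
  have h2 : (N : ℝ) / c < y := by
    by_contra h
    exact hy.2 ⟨h1, not_lt.1 h⟩
  rw [div_lt_iff₀ hc] at h2
  exact Nat.lt_ceil.2 h2

/-- The step function only sees `t ≥ 1`, hence the condition on `j`. -/
theorem avoidSum_div_sqrt_eq {n j : ℕ} (hn : 0 < n) (hj : 1 ≤ j) :
    avoidSum n j / √n =
      ∫ y in Set.Ioi (0 : ℝ), if j ≤ ⌈y * √n⌉₊ then avoidProb n ⌈y * √n⌉₊ else 0 := by
  have hc : 0 < √(n : ℝ) := Real.sqrt_pos.2 (by exact_mod_cast hn)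
  rw [integral_comp_ceil_mul hc (fun t => if j ≤ t then avoidProb n t else 0) n
    fun t ht => by simp [avoidProb_eq_zero hn ht.le], avoidSum]
  congr 1
  rw [← Finset.sum_filter]
  refine Finset.sum_congr ?_ fun _ _ => rfl
  ext t
  simp only [Finset.mem_filter, Finset.mem_Icc]
  omega

/-- The ceiling rounds up, so the Gaussian bound becomes a majorant independent of `n`. -/
theorem avoidProb_ceil_le {n : ℕ} (hn : 0 < n) {y : ℝ} (hy : 0 ≤ y) :
    avoidProb n ⌈y * √n⌉₊ ≤ Real.exp (-(y ^ 2 / 2)) := by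
  have hn' : (0 : ℝ) < n := by exact_mod_cast hn
  refine (avoidProb_le hn _).trans ?_
  rw [Real.exp_le_exp, neg_le_neg_iff]
  have h1 : y * √n ≤ ⌈y * √n⌉₊ := Nat.le_ceil _
  have h2 : y ^ 2 * n ≤ (⌈y * √n⌉₊ : ℝ) ^ 2 := by
    calc y ^ 2 * n = (y * √n) ^ 2 := by rw [mul_pow, Real.sq_sqrt hn'.le]
      _ ≤ _ := by gcongr
  rw [div_le_div_iff₀ (by norm_num) (by positivity)]
  linarith

theorem exp_neg_sq_div_le (y : ℝ) : Real.exp (-(y ^ 2 / 2)) ≤ Real.exp 2 * Real.exp (-(2 * y)) := by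
  rw [← Real.exp_add, Real.exp_le_exp]
  nlinarith [sq_nonneg (y - 2)]

theorem integrable_exp_neg_sq_div : Integrable fun y : ℝ => Real.exp (-(y ^ 2 / 2)) := by
  have := integrable_exp_neg_mul_sq (b := 1 / 2) (by norm_num)
  refine this.congr (ae_of_all _ fun y => ?_)
  simp only
  congr 1
  ring

theorem tendsto_avoidSum_div_sqrt_of_ae {j : ℕ → ℕ} (hj : ∀ᶠ n in atTop, 1 ≤ j n) {g : ℝ → ℝ}
    (h : ∀ᵐ y ∂(volume.restrict (Set.Ioi (0 : ℝ))),
      Tendsto (fun n => if j n ≤ ⌈y * √n⌉₊ then avoidProb n ⌈y * √n⌉₊ else 0) atTop (𝓝 (g y))) :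
    Tendsto (fun n => avoidSum n (j n) / √n) atTop (𝓝 (∫ y in Set.Ioi (0 : ℝ), g y)) := by
  have key : Tendsto (fun n => ∫ y in Set.Ioi (0 : ℝ),
      if j n ≤ ⌈y * √n⌉₊ then avoidProb n ⌈y * √n⌉₊ else 0) atTop
      (𝓝 (∫ y in Set.Ioi (0 : ℝ), g y)) := by
    refine tendsto_integral_filter_of_dominated_convergence
      (fun y => Real.exp (-(y ^ 2 / 2))) ?_ ?_ integrable_exp_neg_sq_div.integrableOn h
    · exact Eventually.of_forall fun n => (measurable_comp_ceil_mul (√n)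
        (fun t => if j n ≤ t then avoidProb n t else 0)).aestronglyMeasurable
    · filter_upwards [eventually_gt_atTop 0] with n hn
      filter_upwards [ae_restrict_mem measurableSet_Ioi] with y hy
      have hy' : (0 : ℝ) ≤ y := le_of_lt hy
      split_ifs
      · rw [Real.norm_of_nonneg (avoidProb_nonneg hn _)]
        exact avoidProb_ceil_le hn hy'
      · simpa using (Real.exp_pos _).le
  refine key.congr' ?_
  filter_upwards [hj, eventually_gt_atTop 0] with n hjn hn
  rw [avoidSum_div_sqrt_eq hn hjn]

theorem tendsto_avoidSum_div_sqrt {j : ℕ → ℕ} (hj : ∀ᶠ n in atTop, 1 ≤ j n) {d : ℝ} (hd : 0 ≤ d)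
    (h : Tendsto (fun n => (j n : ℝ) / √n) atTop (𝓝 d)) :
    Tendsto (fun n => avoidSum n (j n) / √n) atTop (𝓝 (Real.exp (-1) * gaussTail d)) := by
  have e : Real.exp (-1) * gaussTail d = ∫ y in Set.Ioi (0 : ℝ),
      (Set.Ioi d).indicator (fun y => Real.exp (-1) * Real.exp (-(y ^ 2 / 2))) y := by
    rw [setIntegral_indicator measurableSet_Ioi, Set.Ioi_inter_Ioi, sup_eq_right.2 hd, gaussTail,
      integral_const_mul]
  rw [e]
  refine tendsto_avoidSum_div_sqrt_of_ae hj ?_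
  -- At `y = d` the cutoff `j n ≤ ⌈y √n⌉` need not settle; this point is null.
  have hne : ∀ᵐ y ∂(volume.restrict (Set.Ioi (0 : ℝ))), y ≠ d :=
    ae_restrict_of_ae (Measure.ae_ne volume d)
  filter_upwards [hne, ae_restrict_mem measurableSet_Ioi] with y hyd hy
  have hc := tendsto_ceil_mul_sqrt_div (le_of_lt hy : (0 : ℝ) ≤ y)
  have hpos : ∀ᶠ n : ℕ in atTop, 0 < √(n : ℝ) := tendsto_sqrt_natCast.eventually_gt_atTop 0
  rcases lt_or_gt_of_ne hyd with hlt | hlt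
  · rw [Set.indicator_of_notMem (by simpa using hlt.le)]
    refine tendsto_const_nhds.congr' ?_
    filter_upwards [hc.eventually_lt h hlt, hpos] with n h1 h2
    rw [div_lt_div_iff_of_pos_right h2] at h1
    rw [if_neg (by exact_mod_cast not_le.2 h1)]
  · rw [Set.indicator_of_mem (by simpa using hlt)]
    refine (tendsto_avoidProb hc).congr' ?_
    filter_upwards [h.eventually_lt hc hlt, hpos] with n h1 h2
    rw [div_lt_div_iff_of_pos_right h2] at h1
    rw [if_pos (by exact_mod_cast h1.le)]

theorem tendsto_avoidSum_div_sqrt_atTop {j : ℕ → ℕ}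
    (h : Tendsto (fun n => (j n : ℝ) / √n) atTop atTop) :
    Tendsto (fun n => avoidSum n (j n) / √n) atTop (𝓝 0) := by
  have e : (0 : ℝ) = ∫ y in Set.Ioi (0 : ℝ), (0 : ℝ) := by simp
  rw [e]
  refine tendsto_avoidSum_div_sqrt_of_ae ?_ ?_
  · filter_upwards [h.eventually_gt_atTop 0] with n hn
    by_contra h0
    simp [show j n = 0 by omega] at hn
  · filter_upwards [ae_restrict_mem measurableSet_Ioi] with y hy
    have hc := tendsto_ceil_mul_sqrt_div (le_of_lt hy : (0 : ℝ) ≤ y)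
    refine tendsto_const_nhds.congr' ?_
    filter_upwards [hc.eventually (gt_mem_nhds (lt_add_one y)), h.eventually_ge_atTop (y + 1),
      tendsto_sqrt_natCast.eventually_gt_atTop 0] with n h1 h2 h3
    have h4 := h1.trans_le h2
    rw [div_lt_div_iff_of_pos_right h3] at h4
    rw [if_neg (by exact_mod_cast not_le.2 h4)]

theorem avoidSum_nonneg {n : ℕ} (hn : 0 < n) (j : ℕ) : 0 ≤ avoidSum n j :=
  Finset.sum_nonneg fun t _ => avoidProb_nonneg hn t

theorem avoidSum_eq_zero {n j : ℕ} (hj : n < j) : avoidSum n j = 0 := by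
  rw [avoidSum, Finset.Icc_eq_empty (by omega), Finset.sum_empty]

theorem avoidSum_le {n j : ℕ} (hj : 1 ≤ j) (hn : 0 < n) :
    avoidSum n j ≤ n * Real.exp (-((j : ℝ) ^ 2 / (2 * n))) := by
  calc avoidSum n j ≤ ∑ t ∈ Finset.Icc j n, Real.exp (-((j : ℝ) ^ 2 / (2 * n))) := by
        refine Finset.sum_le_sum fun t ht => (avoidProb_le hn t).trans ?_
        have : (j : ℝ) ≤ t := by exact_mod_cast (Finset.mem_Icc.1 ht).1
        gcongr
    _ ≤ _ := by
        rw [Finset.sum_const, Nat.card_Icc, nsmul_eq_mul]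
        gcongr
        omega

/-- An integrable majorant in `y`, uniform in `n`, for integrating the tail sums against test
functions. -/
theorem avoidSum_ceil_div_sqrt_le {n : ℕ} (hn : 0 < n) {y : ℝ} (hy : 0 < y) :
    avoidSum n ⌈y * √n⌉₊ / √n ≤ Real.exp 3 * Real.exp (-y) := by
  have hn1 : (1 : ℝ) ≤ √n := Real.one_le_sqrt.2 (by exact_mod_cast hn)
  rw [avoidSum_div_sqrt_eq hn (Nat.one_le_ceil_iff.2 (by positivity))]
  calc _ ≤ ∫ z in Set.Ioi (0 : ℝ), Real.exp 3 * Real.exp (-y) * Real.exp (-z) := by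
        refine setIntegral_mono_on_ae ?_ ((integrableOn_exp_neg_Ioi 0).const_mul _)
          measurableSet_Ioi (ae_of_all _ fun z hz => ?_)
        · refine Integrable.mono' integrable_exp_neg_sq_div.integrableOn
            (measurable_comp_ceil_mul (√n)
            (fun t => if ⌈y * √n⌉₊ ≤ t then avoidProb n t else 0)).aestronglyMeasurable ?_
          filter_upwards [ae_restrict_mem measurableSet_Ioi] with z hz
          split_ifs
          · rw [Real.norm_of_nonneg (avoidProb_nonneg hn _)]
            exact avoidProb_ceil_le hn (le_of_lt hz)
          · simpa using (Real.exp_pos _).le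
        · split_ifs with h
          · refine (avoidProb_ceil_le hn (le_of_lt hz)).trans ((exp_neg_sq_div_le z).trans ?_)
            rw [← Real.exp_add, ← Real.exp_add, ← Real.exp_add, Real.exp_le_exp]
            -- Rounding costs less than `1/√n ≤ 1` in `y - z`; this turns the constant `e²` into
            -- `e³`.
            have h1 : y * √n < z * √n + 1 := by
              have hz' : (0 : ℝ) ≤ z * √n := mul_nonneg (le_of_lt hz) (by positivity)
              calc y * √n ≤ ⌈y * √n⌉₊ := Nat.le_ceil _
                _ ≤ ⌈z * √n⌉₊ := by exact_mod_cast h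
                _ < _ := Nat.ceil_lt_add_one hz'
            have h2 : y - z < 1 := by
              by_contra h3
              nlinarith
            linarith
          · positivity
    _ = _ := by rw [integral_const_mul, integral_exp_neg_Ioi_zero, mul_one]

/-! ### Integrals of test functions against the two parts of the law -/

/-- Sums against the part of the law coming from the shuffles with no card inserted in front. -/
theorem tendsto_sum_mul_avoidSum {G : ℕ → ℕ → ℝ} {g : ℝ → ℝ} {M : ℝ} (hM : ∀ n j, |G n j| ≤ M)
    (hG : ∀ y > (0 : ℝ), Tendsto (fun n : ℕ => G n ⌈y * √n⌉₊) atTop (𝓝 (g y))) :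
    Tendsto (fun n : ℕ => ∑ j ∈ Finset.Icc 1 n, G n j * avoidSum n j / n) atTop
      (𝓝 (∫ y in Set.Ioi (0 : ℝ), g y * (Real.exp (-1) * gaussTail y))) := by
  have key : Tendsto (fun n : ℕ => ∫ y in Set.Ioi (0 : ℝ),
      G n ⌈y * √n⌉₊ * (avoidSum n ⌈y * √n⌉₊ / √n)) atTop
      (𝓝 (∫ y in Set.Ioi (0 : ℝ), g y * (Real.exp (-1) * gaussTail y))) := by
    refine tendsto_integral_filter_of_dominated_convergence
      (fun y => M * (Real.exp 3 * Real.exp (-y))) ?_ ?_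
      (((integrableOn_exp_neg_Ioi 0).const_mul _).const_mul _) ?_
    · exact Eventually.of_forall fun n => (measurable_comp_ceil_mul (√n)
        (fun t => G n t * (avoidSum n t / √n))).aestronglyMeasurable
    · filter_upwards [eventually_gt_atTop 0] with n hn
      filter_upwards [ae_restrict_mem measurableSet_Ioi] with y hy
      have h0 : 0 ≤ avoidSum n ⌈y * √n⌉₊ / √n := div_nonneg (avoidSum_nonneg hn _) (by positivity)
      rw [norm_mul, Real.norm_eq_abs, Real.norm_of_nonneg h0]
      exact mul_le_mul (hM _ _) (avoidSum_ceil_div_sqrt_le hn hy) h0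
        ((abs_nonneg _).trans (hM 0 0))
    · filter_upwards [ae_restrict_mem measurableSet_Ioi] with y hy
      refine (hG y hy).mul (tendsto_avoidSum_div_sqrt ?_ (le_of_lt hy)
        (tendsto_ceil_mul_sqrt_div (le_of_lt hy)))
      filter_upwards [tendsto_sqrt_natCast.eventually_gt_atTop 0] with n hn
      exact Nat.one_le_ceil_iff.2 (mul_pos hy hn)
  refine key.congr' ?_
  filter_upwards [eventually_gt_atTop 0] with n hn
  have hn' : (0 : ℝ) < n := by exact_mod_cast hn
  rw [integral_comp_ceil_mul (Real.sqrt_pos.2 hn') (fun t => G n t * (avoidSum n t / √n)) n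
    fun t ht => by simp [avoidSum_eq_zero ht], Finset.sum_div]
  refine Finset.sum_congr rfl fun j _ => ?_
  rw [mul_div_assoc, mul_div_assoc, div_div, Real.mul_self_sqrt hn'.le]

theorem tendsto_natCast_sub_div {j : ℕ → ℕ} {b : ℝ} (hj : ∀ᶠ n in atTop, j n ≤ n)
    (h : Tendsto (fun n => (j n : ℝ) / n) atTop (𝓝 b)) :
    Tendsto (fun n => ((n - j n : ℕ) : ℝ) / n) atTop (𝓝 (1 - b)) := by
  refine (tendsto_const_nhds.sub h).congr' ?_
  filter_upwards [hj, eventually_gt_atTop 0] with n hn hn0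
  have : (n : ℝ) ≠ 0 := by exact_mod_cast hn0.ne'
  rw [Nat.cast_sub hn, sub_div, div_self this]

/-- Sums against the part of the law coming from the shuffles with a card inserted in front. -/
theorem tendsto_sum_mul_pow {G : ℕ → ℕ → ℝ} {g : ℝ → ℝ} {M : ℝ} (hM : ∀ n j, |G n j| ≤ M)
    (hG : ∀ y > (0 : ℝ), Tendsto (fun n : ℕ => G n ⌈y * n⌉₊) atTop (𝓝 (g y))) :
    Tendsto (fun n : ℕ => ∑ j ∈ Finset.Icc 1 n, G n j * (1 - 1 / (n : ℝ)) ^ (n - j) / n) atTop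
      (𝓝 (∫ y in Set.Ioc (0 : ℝ) 1, g y * Real.exp (y - 1))) := by
  have e : ∫ y in Set.Ioc (0 : ℝ) 1, g y * Real.exp (y - 1) =
      ∫ y in Set.Ioi (0 : ℝ), (Set.Iic 1).indicator (fun y => g y * Real.exp (y - 1)) y := by
    rw [setIntegral_indicator measurableSet_Iic, Set.Ioi_inter_Iic]
  have key : Tendsto (fun n : ℕ => ∫ y in Set.Ioi (0 : ℝ),
      if ⌈y * n⌉₊ ≤ n then G n ⌈y * n⌉₊ * (1 - 1 / (n : ℝ)) ^ (n - ⌈y * n⌉₊) else 0) atTop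
      (𝓝 (∫ y in Set.Ioc (0 : ℝ) 1, g y * Real.exp (y - 1))) := by
    rw [e]
    have hceil : ∀ (n : ℕ) (y : ℝ), 0 < n → (⌈y * n⌉₊ ≤ n ↔ y ≤ 1) := by
      intro n y hn
      have hn' : (0 : ℝ) < n := by exact_mod_cast hn
      rw [Nat.ceil_le, mul_le_iff_le_one_left hn']
    refine tendsto_integral_filter_of_dominated_convergence
      ((Set.Iic 1).indicator fun _ => M) ?_ ?_ ?_ ?_
    · exact Eventually.of_forall fun n => (measurable_comp_ceil_mul n
        (fun t => if t ≤ n then G n t * (1 - 1 / (n : ℝ)) ^ (n - t) else 0)).aestronglyMeasurable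
    · filter_upwards [eventually_gt_atTop 0] with n hn
      refine ae_of_all _ fun y => ?_
      by_cases hy : y ≤ 1
      · rw [if_pos ((hceil n y hn).2 hy), Set.indicator_of_mem (Set.mem_Iic.2 hy), norm_mul, Real.norm_eq_abs,
          Real.norm_of_nonneg (pow_nonneg (one_sub_inv_natCast_nonneg hn) _), ← mul_one M]
        exact mul_le_mul (hM _ _)
          (pow_le_one₀ (one_sub_inv_natCast_nonneg hn) (one_sub_inv_natCast_le_one n))
          (pow_nonneg (one_sub_inv_natCast_nonneg hn) _) ((abs_nonneg _).trans (hM 0 0))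
      · rw [if_neg (mt (hceil n y hn).1 hy), Set.indicator_of_notMem (mt Set.mem_Iic.1 hy), norm_zero]
    · rw [integrable_indicator_iff measurableSet_Iic, IntegrableOn,
        Measure.restrict_restrict measurableSet_Iic, Set.Iic_inter_Ioi]
      simp
    · filter_upwards [ae_restrict_mem measurableSet_Ioi] with y hy
      have hy0 : (0 : ℝ) < y := hy
      by_cases hy1 : y ≤ 1
      · rw [Set.indicator_of_mem (Set.mem_Iic.2 hy1)]
        have hle : ∀ᶠ n : ℕ in atTop, ⌈y * n⌉₊ ≤ n := by
          filter_upwards [eventually_gt_atTop 0] with n hn using (hceil n y hn).2 hy1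
        have h1 := tendsto_one_sub_inv_pow (tendsto_natCast_sub_div hle
          ((tendsto_nat_ceil_mul_div_atTop hy0.le).comp tendsto_natCast_atTop_atTop))
        rw [neg_sub] at h1
        refine ((hG y hy0).mul h1).congr' ?_
        filter_upwards [hle] with n hn
        rw [if_pos hn]
      · rw [Set.indicator_of_notMem (mt Set.mem_Iic.1 hy1)]
        refine tendsto_const_nhds.congr' ?_
        filter_upwards [eventually_gt_atTop 0] with n hn
        rw [if_neg (mt (hceil n y hn).1 hy1)]
  refine key.congr' ?_
  filter_upwards [eventually_gt_atTop 0] with n hn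
  have hn' : (0 : ℝ) < n := by exact_mod_cast hn
  rw [integral_comp_ceil_mul hn'
    (fun t => if t ≤ n then G n t * (1 - 1 / (n : ℝ)) ^ (n - t) else 0) n
    fun t ht => if_neg (by omega), Finset.sum_div]
  exact Finset.sum_congr rfl fun j hj => by rw [if_pos (Finset.mem_Icc.1 hj).2]

/-! ### The Gaussian tail and the limit measures -/

theorem gaussTail_nonneg (d : ℝ) : 0 ≤ gaussTail d :=
  integral_nonneg fun _ => (Real.exp_pos _).le

theorem hasDerivAt_gaussTail (d : ℝ) : HasDerivAt gaussTail (-Real.exp (-(d ^ 2 / 2))) d := by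
  have e : gaussTail = fun d => gaussTail 0 - ∫ y in (0 : ℝ)..d, Real.exp (-(y ^ 2 / 2)) := by
    ext d
    rw [gaussTail, gaussTail, ← intervalIntegral.integral_interval_add_Ioi (a := 0) (b := d)
      integrable_exp_neg_sq_div.integrableOn integrable_exp_neg_sq_div.integrableOn]
    ring
  have hc : Continuous fun y : ℝ => Real.exp (-(y ^ 2 / 2)) := by fun_prop
  rw [e]
  exact (hc.integral_hasStrictDerivAt 0 d).hasDerivAt.const_sub _

theorem continuous_gaussTail : Continuous gaussTail :=
  continuous_iff_continuousAt.2 fun d => (hasDerivAt_gaussTail d).continuousAt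

theorem gaussTail_le {d : ℝ} (hd : 0 ≤ d) : gaussTail d ≤ Real.exp 2 * Real.exp (-d) := by
  rw [← integral_exp_neg_Ioi, ← integral_const_mul]
  refine setIntegral_mono_on integrable_exp_neg_sq_div.integrableOn
    ((integrableOn_exp_neg_Ioi d).const_mul _) measurableSet_Ioi fun y hy => ?_
  refine (exp_neg_sq_div_le y).trans ?_
  have : 0 < y := lt_of_le_of_lt hd hy
  gcongr
  linarith

/-- This antiderivative, from integration by parts, rises from `-1` at `0` to `0` at infinity,
giving both integrability and total mass `1`. -/
theorem hasDerivAt_mul_gaussTail_sub (y : ℝ) :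
    HasDerivAt (fun y => y * gaussTail y - Real.exp (-(y ^ 2 / 2))) (gaussTail y) y := by
  have h1 : HasDerivAt (fun y : ℝ => -(y ^ 2 / 2)) (-y) y := by
    have := ((hasDerivAt_pow 2 y).div_const 2).neg
    refine this.congr_deriv ?_
    simp
  refine (((hasDerivAt_id' y).mul (hasDerivAt_gaussTail y)).sub h1.exp).congr_deriv ?_
  ring

theorem tendsto_mul_gaussTail_sub :
    Tendsto (fun y => y * gaussTail y - Real.exp (-(y ^ 2 / 2))) atTop (𝓝 0) := by
  have h0 := Real.tendsto_pow_mul_exp_neg_atTop_nhds_zero 1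
  have h1 : Tendsto (fun y => y * gaussTail y) atTop (𝓝 0) := by
    have h2 := h0.const_mul (Real.exp 2)
    rw [mul_zero] at h2
    refine squeeze_zero' ?_ ?_ h2
    · filter_upwards [eventually_ge_atTop 0] with y hy using mul_nonneg hy (gaussTail_nonneg y)
    · filter_upwards [eventually_ge_atTop 0] with y hy
      calc y * gaussTail y ≤ y * (Real.exp 2 * Real.exp (-y)) :=
            mul_le_mul_of_nonneg_left (gaussTail_le hy) hy
        _ = _ := by ring
  have h3 : Tendsto (fun y : ℝ => Real.exp (-(y ^ 2 / 2))) atTop (𝓝 0) :=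
    Real.tendsto_exp_neg_atTop_nhds_zero.comp
      ((tendsto_pow_atTop (by norm_num)).atTop_div_const (by norm_num))
  simpa using h1.sub h3

theorem integrableOn_gaussTail : IntegrableOn gaussTail (Set.Ioi 0) :=
  integrableOn_Ioi_deriv_of_nonneg
    (hasDerivAt_mul_gaussTail_sub 0).continuousAt.continuousWithinAt
    (fun y _ => hasDerivAt_mul_gaussTail_sub y) (fun y _ => gaussTail_nonneg y)
    tendsto_mul_gaussTail_sub

theorem integral_gaussTail : ∫ y in Set.Ioi 0, gaussTail y = 1 := by
  rw [integral_Ioi_of_hasDerivAt_of_tendsto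
    (hasDerivAt_mul_gaussTail_sub 0).continuousAt.continuousWithinAt
    (fun y _ => hasDerivAt_mul_gaussTail_sub y) integrableOn_gaussTail tendsto_mul_gaussTail_sub]
  simp

theorem muLimit_univ : muLimit Set.univ = ENNReal.ofReal (Real.exp (-1)) := by
  rw [muLimit, withDensity_apply _ MeasurableSet.univ, Measure.restrict_univ]
  refine (lintegral_subtype_comap (measurableSet_Ici (a := (0 : ℝ)))
    fun x => ENNReal.ofReal (Real.exp (-1) * gaussTail x)).trans ?_
  rw [setLIntegral_congr Ioi_ae_eq_Ici.symm,
    ← ofReal_integral_eq_lintegral_ofReal (integrableOn_gaussTail.const_mul _)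
      (ae_of_all _ fun y => mul_nonneg (Real.exp_pos _).le (gaussTail_nonneg y)),
    integral_const_mul, integral_gaussTail, mul_one]

theorem integral_muLimit (f : ℝ≥0 → ℝ) :
    ∫ x, f x ∂muLimit =
      ∫ y in Set.Ioi (0 : ℝ), f y.toNNReal * (Real.exp (-1) * gaussTail y) := by
  have hm : Measurable fun x : ℝ≥0 => ENNReal.ofReal (Real.exp (-1) * gaussTail x) :=
    ENNReal.measurable_ofReal.comp
      (((continuous_gaussTail.comp NNReal.continuous_coe).const_mul _).measurable)
  rw [muLimit, integral_withDensity_eq_integral_toReal_smul hm (ae_of_all _ fun x => by simp),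
    ← setIntegral_congr_set Ioi_ae_eq_Ici.symm]
  refine Eq.trans ?_ (integral_subtype_comap (measurableSet_Ici (a := (0 : ℝ)))
    fun y => f y.toNNReal * (Real.exp (-1) * gaussTail y))
  refine integral_congr_ae (ae_of_all _ fun x => ?_)
  have hx : Real.toNNReal (x : ℝ) = x := Real.toNNReal_coe
  simp only [smul_eq_mul]
  rw [ENNReal.toReal_ofReal (mul_nonneg (Real.exp_pos _).le (gaussTail_nonneg _)), mul_comm]
  exact congrArg (fun z => f z * _) hx.symm

theorem integral_nuLimit (f : BoundedContinuousFunction unitInterval ℝ) :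
    ∫ x, f x ∂nuLimitMeasure = Real.exp (-1) * f 0 +
      ∫ y in Set.Ioc (0 : ℝ) 1, f (Set.projIcc 0 1 zero_le_one y) * Real.exp (y - 1) := by
  have h : IsProbabilityMeasure nuLimitMeasure := inferInstance
  have hf : Integrable f nuLimitMeasure := f.integrable _
  rw [nuLimitMeasure] at hf ⊢
  have hm : Measurable fun x : unitInterval => ENNReal.ofReal (Real.exp ((x : ℝ) - 1)) := by
    fun_prop
  rw [integral_add_measure hf.left_of_add_measure hf.right_of_add_measure, integral_smul_measure,
    integral_dirac, ENNReal.toReal_ofReal (Real.exp_pos _).le, smul_eq_mul,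
    integral_withDensity_eq_integral_toReal_smul hm (ae_of_all _ fun x => by simp)]
  congr 1
  rw [← integral_Icc_eq_integral_Ioc]
  refine Eq.trans ?_ (integral_subtype_comap (measurableSet_Icc (a := (0 : ℝ)) (b := 1))
    fun y => f (Set.projIcc 0 1 zero_le_one y) * Real.exp (y - 1))
  refine integral_congr_ae (ae_of_all _ fun x => ?_)
  simp only [smul_eq_mul]
  rw [ENNReal.toReal_ofReal (Real.exp_pos _).le, Set.projIcc_val, mul_comm]

/-! ### Convergence of the rescaled laws -/

theorem sum_mul_probFirst (n : ℕ) (G : ℕ → ℝ) :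
    ∑ j ∈ Finset.Icc 1 n, G j * probFirst n j =
      ∑ j ∈ Finset.Icc 1 n, G j * (1 - 1 / (n : ℝ)) ^ (n - j) / n +
        ∑ j ∈ Finset.Icc 1 n, G j * avoidSum n j / n := by
  rw [← Finset.sum_add_distrib]
  refine Finset.sum_congr rfl fun j hj => ?_
  rw [Finset.mem_Icc] at hj
  rw [probFirst_natCast hj.1 hj.2]
  ring

/-- The power part gives the density. The other part sits at `σ_1` of order `√n`, where the test
function is evaluated near `0`, and becomes the atom of mass `e⁻¹ ∫ gaussTail = e⁻¹`. -/
theorem tendsto_nuF : Tendsto nuF atTop (𝓝 nuLimit) := by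
  rw [ProbabilityMeasure.tendsto_iff_forall_integral_tendsto]
  intro f
  have hg : Continuous fun x : ℝ => f (Set.projIcc 0 1 zero_le_one x) :=
    f.continuous.comp continuous_projIcc
  have h1 := tendsto_sum_mul_pow (G := fun n j => f (Set.projIcc 0 1 zero_le_one ((j : ℝ) / n)))
    (M := ‖f‖) (fun n j => f.norm_coe_le_norm _) fun y hy => (hg.tendsto y).comp
      ((tendsto_nat_ceil_mul_div_atTop (le_of_lt hy)).comp tendsto_natCast_atTop_atTop)
  have h2 := tendsto_sum_mul_avoidSum
    (G := fun n j => f (Set.projIcc 0 1 zero_le_one ((j : ℝ) / n)))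
    (M := ‖f‖) (fun n j => f.norm_coe_le_norm _) fun y hy => (hg.tendsto 0).comp
      (tendsto_div_natCast_of_div_sqrt (tendsto_ceil_mul_sqrt_div (le_of_lt hy)))
  have e : ∫ x, f x ∂(nuLimit : Measure unitInterval) = _ := integral_nuLimit f
  rw [integral_const_mul, integral_const_mul, integral_gaussTail, mul_one,
    Set.projIcc_left, mul_comm (f _)] at h2
  rw [e, add_comm]
  refine (h1.add h2).congr' ?_
  filter_upwards [eventually_gt_atTop 0] with n hn
  rw [← sum_mul_probFirst, ← integral_firstCard hn
    fun j => f (Set.projIcc 0 1 zero_le_one ((j : ℝ) / n))]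
  refine Eq.trans ?_ (integral_map (Measurable.of_discrete).aemeasurable
    f.continuous.aestronglyMeasurable).symm
  refine integral_congr_ae (ae_of_all _ fun σ => congrArg f ?_)
  exact Set.projIcc_of_mem zero_le_one (firstCardUnit σ).2

/-- The power part now escapes to infinity: at `j = ⌈y n⌉` one has `j/√n ≥ y √n`, and `f` vanishes
there in the limit. -/
theorem tendsto_integral_muF (f : C₀(ℝ≥0, ℝ)) :
    Tendsto (fun n : ℕ => ∫ x, f x ∂(muF n)) atTop (𝓝 (∫ x, f x ∂muLimit)) := by
  have hg : Continuous fun x : ℝ => f x.toNNReal := f.continuous.comp continuous_real_toNNReal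
  have hM : ∀ n j : ℕ, |f ((j : ℝ) / √n).toNNReal| ≤ ‖f.toBCF‖ :=
    fun n j => f.toBCF.norm_coe_le_norm _
  have h1 := tendsto_sum_mul_pow (G := fun n j => f ((j : ℝ) / √n).toNNReal) (g := fun _ => 0)
    hM fun y hy => by
      refine ((zero_at_infty f).mono_left atTop_le_cocompact).comp
        (Real.tendsto_toNNReal_atTop.comp ?_)
      refine tendsto_atTop_mono' _ ?_ (tendsto_sqrt_natCast.const_mul_atTop hy)
      filter_upwards [tendsto_sqrt_natCast.eventually_gt_atTop 0] with n hn
      rw [le_div_iff₀ hn, mul_assoc, Real.mul_self_sqrt (Nat.cast_nonneg n)]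
      exact Nat.le_ceil _
  have h2 := tendsto_sum_mul_avoidSum (G := fun n j => f ((j : ℝ) / √n).toNNReal) hM
    fun y hy => (hg.tendsto y).comp (tendsto_ceil_mul_sqrt_div (le_of_lt hy))
  have h3 := h1.add h2
  simp only [zero_mul, integral_zero, zero_add] at h3
  rw [integral_muLimit]
  refine h3.congr' ?_
  filter_upwards [eventually_gt_atTop 0] with n hn
  rw [← sum_mul_probFirst, ← integral_firstCard hn fun j => f ((j : ℝ) / √n).toNNReal]
  refine Eq.trans ?_ (integral_map (Measurable.of_discrete).aemeasurable
    f.continuous.aestronglyMeasurable).symm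
  refine integral_congr_ae (ae_of_all _ fun σ => congrArg f ?_)
  rw [firstCardSqrt, Real.toNNReal_div (Nat.cast_nonneg _), Real.toNNReal_natCast]
  congr 1
  ext
  simp

/-! ### Local limits -/

theorem exists_natCast_of_eventually_isCardNumber {x : ℕ → ℝ}
    (h : ∀ᶠ n in atTop, IsCardNumber n (x n)) :
    ∃ j : ℕ → ℕ, ∀ᶠ n in atTop, 1 ≤ j n ∧ j n ≤ n ∧ x n = j n := by
  refine ⟨fun n => ⌊x n⌋₊, h.mono ?_⟩
  rintro n ⟨j, h1, h2, h3⟩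
  simp only [h3, Nat.floor_natCast]
  exact ⟨h1, h2, trivial⟩

/-- At most `n` terms, each at most `exp(-j²/(2n)) ≤ n^(-c²/2)`, so the sum is at most `n^(1 -
c²/2)`: this is the origin of the threshold `√2`. -/
theorem tendsto_avoidSum_zero {j : ℕ → ℕ} {c : ℝ} (hc : √2 < c)
    (hj : ∀ᶠ n in atTop, 1 ≤ j n)
    (h : ∀ᶠ n : ℕ in atTop, c * (√n * √(Real.log n)) ≤ j n) :
    Tendsto (fun n => avoidSum n (j n)) atTop (𝓝 0) := by
  have hc0 : 0 < c := (Real.sqrt_nonneg 2).trans_lt hc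
  have hc2 : 0 < c ^ 2 / 2 - 1 := by
    have := (Real.sqrt_lt' hc0).1 hc
    linarith
  refine squeeze_zero' ?_ ?_ ((tendsto_rpow_neg_atTop hc2).comp tendsto_natCast_atTop_atTop)
  · filter_upwards [eventually_gt_atTop 0] with n hn using avoidSum_nonneg hn _
  · filter_upwards [eventually_gt_atTop 0, h, hj] with n hn h1 h2
    have hn' : (0 : ℝ) < n := by exact_mod_cast hn
    have hlog : 0 ≤ Real.log n := Real.log_natCast_nonneg n
    refine (avoidSum_le h2 hn).trans ?_
    have h3 : c ^ 2 * (n * Real.log n) ≤ (j n : ℝ) ^ 2 := by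
      calc c ^ 2 * (n * Real.log n) = (c * (√n * √(Real.log n))) ^ 2 := by
            rw [mul_pow, mul_pow, Real.sq_sqrt hn'.le, Real.sq_sqrt hlog]
        _ ≤ _ := by gcongr
    have h4 : c ^ 2 / 2 * Real.log n ≤ (j n : ℝ) ^ 2 / (2 * n) := by
      rw [le_div_iff₀ (by positivity)]
      linarith
    calc (n : ℝ) * Real.exp (-((j n : ℝ) ^ 2 / (2 * n)))
        ≤ Real.exp (Real.log n) * Real.exp (-(c ^ 2 / 2 * Real.log n)) := by
          rw [Real.exp_log hn']
          gcongr
      _ = (n : ℝ) ^ (-(c ^ 2 / 2 - 1)) := by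
          rw [← Real.exp_add, Real.rpow_def_of_pos hn']
          congr 1
          ring

/-- Common source of the limits on the scale `n` and on the intermediate scale (`β = 0`): only the
power survives. -/
theorem tendsto_natCast_mul_probFirst {b : ℕ → ℝ} {β c : ℝ} (hc : √2 < c)
    (hcard : ∀ᶠ n : ℕ in atTop, IsCardNumber n (b n * n)) (hb : Tendsto b atTop (𝓝 β))
    (h : ∀ᶠ n : ℕ in atTop, c * (√n * √(Real.log n)) ≤ b n * n) :
    Tendsto (fun n : ℕ => (n : ℝ) * probFirst n (b n * n)) atTop (𝓝 (Real.exp (β - 1))) := by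
  obtain ⟨j, hj⟩ := exists_natCast_of_eventually_isCardNumber hcard
  have hjb : Tendsto (fun n => (j n : ℝ) / n) atTop (𝓝 β) := by
    refine hb.congr' ?_
    filter_upwards [hj, eventually_gt_atTop 0] with n hn hn0
    have : (n : ℝ) ≠ 0 := by exact_mod_cast hn0.ne'
    rw [← hn.2.2, mul_div_cancel_right₀ _ this]
  have h1 := tendsto_one_sub_inv_pow (tendsto_natCast_sub_div (hj.mono fun n hn => hn.2.1) hjb)
  have h2 := tendsto_avoidSum_zero hc (hj.mono fun n hn => hn.1)
    (by filter_upwards [hj, h] with n h3 h4 using h4.trans h3.2.2.le)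
  have h3 := h1.add h2
  rw [neg_sub, add_zero] at h3
  refine h3.congr' ?_
  filter_upwards [hj, eventually_gt_atTop 0] with n hn hn0
  have : (n : ℝ) ≠ 0 := by exact_mod_cast hn0.ne'
  rw [hn.2.2, probFirst_natCast hn.1 hn.2.1]
  field_simp

theorem eventually_mul_sqrt_log_le {ε : ℝ} (hε : 0 < ε) :
    ∀ᶠ n : ℕ in atTop, √n * √(Real.log n) ≤ ε * n := by
  have h := (Real.isLittleO_log_id_atTop.bound (pow_pos hε 2)).and (eventually_ge_atTop 1)
  filter_upwards [tendsto_natCast_atTop_atTop.eventually h] with n hn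
  obtain ⟨h1, h2⟩ := hn
  have hlog := Real.log_nonneg h2
  rw [id, Real.norm_of_nonneg hlog, Real.norm_of_nonneg (by linarith)] at h1
  rw [← Real.sqrt_mul (Nat.cast_nonneg n)]
  refine Real.sqrt_le_iff.2 ⟨by positivity, ?_⟩
  nlinarith

theorem tendsto_natCast_mul_probFirst_of_pos {b : ℕ → ℝ} {β : ℝ} (hβ : 0 < β)
    (hcard : ∀ᶠ n : ℕ in atTop, IsCardNumber n (b n * n)) (hb : Tendsto b atTop (𝓝 β)) :
    Tendsto (fun n : ℕ => (n : ℝ) * probFirst n (b n * n)) atTop (𝓝 (Real.exp (β - 1))) := by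
  have hc : √2 < 2 := by rw [Real.sqrt_lt' two_pos]; norm_num
  refine tendsto_natCast_mul_probFirst hc hcard hb ?_
  -- With `c = 2`, the choice `β/4` gives `2 √(n log n) ≤ (β/2) n ≤ b n * n`.
  filter_upwards [eventually_mul_sqrt_log_le (show 0 < β / 4 by linarith),
    hb.eventually (lt_mem_nhds (half_lt_self hβ))] with n h1 h2
  have : β / 2 * n ≤ b n * n := by gcongr
  linarith

theorem tendsto_natCast_mul_probFirst_of_liminf {b : ℕ → ℝ}
    (hcard : ∀ᶠ n : ℕ in atTop, IsCardNumber n (b n * n)) (hb : Tendsto b atTop (𝓝 0))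
    (h : ((√2 : ℝ) : EReal) <
      liminf (fun n : ℕ => ((√n / √(Real.log n) * b n : ℝ) : EReal)) atTop) :
    Tendsto (fun n : ℕ => (n : ℝ) * probFirst n (b n * n)) atTop (𝓝 (Real.exp (-1))) := by
  -- A real `c` strictly between `√2` and the liminf, which may be infinite.
  obtain ⟨c, hc, hcl⟩ := EReal.lt_iff_exists_real_btwn.1 h
  rw [show (-1 : ℝ) = 0 - 1 by norm_num]
  refine tendsto_natCast_mul_probFirst (EReal.coe_lt_coe_iff.1 hc) hcard hb ?_
  filter_upwards [eventually_lt_of_lt_liminf hcl, eventually_ge_atTop 2] with n h1 h2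
  have h2' : (2 : ℝ) ≤ n := by exact_mod_cast h2
  have hlog : 0 < √(Real.log n) := Real.sqrt_pos.2 (Real.log_pos (by linarith))
  have h3 := (EReal.coe_lt_coe_iff.1 h1).le
  rw [div_mul_eq_mul_div, le_div_iff₀ hlog] at h3
  calc c * (√n * √(Real.log n)) = √n * (c * √(Real.log n)) := by ring
    _ ≤ √n * (√n * b n) := by gcongr
    _ = (√n * √n) * b n := by ring
    _ = b n * n := by rw [Real.mul_self_sqrt (Nat.cast_nonneg n), mul_comm]

/-- The power is at most `1`, so divided by `√n` it disappears and only the tail sum counts. -/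
theorem tendsto_sqrt_mul_probFirst {d : ℕ → ℝ} {j : ℕ → ℕ} {l : ℝ}
    (hj : ∀ᶠ n : ℕ in atTop, 1 ≤ j n ∧ j n ≤ n ∧ d n * √n = j n)
    (h : Tendsto (fun n => avoidSum n (j n) / √n) atTop (𝓝 l)) :
    Tendsto (fun n : ℕ => √n * probFirst n (d n * √n)) atTop (𝓝 l) := by
  have h0 : Tendsto (fun n : ℕ => (1 - 1 / (n : ℝ)) ^ (n - j n) / √n) atTop (𝓝 0) := by
    refine squeeze_zero' ?_ ?_ (tendsto_inv_atTop_zero.comp tendsto_sqrt_natCast)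
    · filter_upwards [eventually_gt_atTop 0] with n hn
      exact div_nonneg (pow_nonneg (one_sub_inv_natCast_nonneg hn) _) (Real.sqrt_nonneg _)
    · filter_upwards [eventually_gt_atTop 0] with n hn
      rw [Function.comp, ← one_div]
      gcongr
      exact pow_le_one₀ (one_sub_inv_natCast_nonneg hn) (one_sub_inv_natCast_le_one n)
  have h1 := h0.add h
  rw [zero_add] at h1
  refine h1.congr' ?_
  filter_upwards [hj, eventually_gt_atTop 0] with n hn hn0
  have hn' : (0 : ℝ) < n := by exact_mod_cast hn0
  have hs : 0 < √(n : ℝ) := Real.sqrt_pos.2 hn'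
  rw [hn.2.2, probFirst_natCast hn.1 hn.2.1]
  nth_rewrite 5 [← Real.mul_self_sqrt hn'.le]
  field_simp

end CardCyclic

theorem theorem1 :
    -- (i) the local limit theorem on the scale `n`, and the weak limit
    ((∀ (b : ℕ → ℝ) (β : ℝ), 0 < β → β ≤ 1 →
        (∀ᶠ n : ℕ in atTop, CardCyclic.IsCardNumber n (b n * n)) →
        Tendsto b atTop (𝓝 β) →
        Tendsto (fun n : ℕ => (n : ℝ) * CardCyclic.probFirst n (b n * n)) atTop
          (𝓝 (Real.exp (β - 1)))) ∧
      Tendsto CardCyclic.nuF atTop (𝓝 CardCyclic.nuLimit)) ∧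
    -- (ii) the intermediate scale
    (∀ b : ℕ → ℝ,
        (∀ᶠ n : ℕ in atTop, CardCyclic.IsCardNumber n (b n * n)) →
        Tendsto b atTop (𝓝 0) →
        ((Real.sqrt 2 : ℝ) : EReal) <
          liminf (fun n : ℕ =>
            ((Real.sqrt n / Real.sqrt (Real.log n) * b n : ℝ) : EReal)) atTop →
        Tendsto (fun n : ℕ => (n : ℝ) * CardCyclic.probFirst n (b n * n)) atTop
          (𝓝 (Real.exp (-1)))) ∧
    -- (iii) the scale `√n`: finite limits, an infinite limit, and the vague limit with its mass
    ((∀ (d : ℕ → ℝ) (δ : ℝ), 0 ≤ δ →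
        (∀ᶠ n : ℕ in atTop, CardCyclic.IsCardNumber n (d n * Real.sqrt n)) →
        Tendsto d atTop (𝓝 δ) →
        Tendsto (fun n : ℕ => Real.sqrt n * CardCyclic.probFirst n (d n * Real.sqrt n)) atTop
          (𝓝 (Real.exp (-1) * CardCyclic.gaussTail δ))) ∧
      (∀ d : ℕ → ℝ,
        (∀ᶠ n : ℕ in atTop, CardCyclic.IsCardNumber n (d n * Real.sqrt n)) →
        Tendsto d atTop atTop →
        Tendsto (fun n : ℕ => Real.sqrt n * CardCyclic.probFirst n (d n * Real.sqrt n)) atTop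
          (𝓝 0)) ∧
      (∀ f : C₀(ℝ≥0, ℝ),
        Tendsto (fun n : ℕ => ∫ x, f x ∂(CardCyclic.muF n)) atTop
          (𝓝 (∫ x, f x ∂CardCyclic.muLimit))) ∧
      CardCyclic.muLimit Set.univ = ENNReal.ofReal (Real.exp (-1))) := by
  have ratio : ∀ {d : ℕ → ℝ} {j : ℕ → ℕ} {l : Filter ℝ},
      (∀ᶠ n : ℕ in atTop, 1 ≤ j n ∧ j n ≤ n ∧ d n * √n = j n) → Tendsto d atTop l →
      Tendsto (fun n => (j n : ℝ) / √n) atTop l := by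
    intro d j l hj hd
    refine hd.congr' ?_
    filter_upwards [hj, CardCyclic.tendsto_sqrt_natCast.eventually_gt_atTop 0] with n hn hn0
    rw [← hn.2.2, mul_div_cancel_right₀ _ hn0.ne']
  refine ⟨⟨fun b β hβ _ hcard hb =>
      CardCyclic.tendsto_natCast_mul_probFirst_of_pos hβ hcard hb, CardCyclic.tendsto_nuF⟩,
    fun b hcard hb h => CardCyclic.tendsto_natCast_mul_probFirst_of_liminf hcard hb h,
    fun d δ hδ hcard hd => ?_, fun d hcard hd => ?_, CardCyclic.tendsto_integral_muF,
    CardCyclic.muLimit_univ⟩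
  · obtain ⟨j, hj⟩ := CardCyclic.exists_natCast_of_eventually_isCardNumber hcard
    exact CardCyclic.tendsto_sqrt_mul_probFirst hj
      (CardCyclic.tendsto_avoidSum_div_sqrt (hj.mono fun n hn => hn.1) hδ (ratio hj hd))
  · obtain ⟨j, hj⟩ := CardCyclic.exists_natCast_of_eventually_isCardNumber hcard
    exact CardCyclic.tendsto_sqrt_mul_probFirst hj
      (CardCyclic.tendsto_avoidSum_div_sqrt_atTop (ratio hj hd))
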